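/- Identify the plane with $\mathbb C$ and let the Klein group $D_2=\{1,\rho,\kappa,\rho\kappa\}$ act on it by $\rho z=-z$, $\kappa z=\bar z$. For $z\in\mathbb C$ the four vortices are placed at $gz$, $g\in D_2$; if they are distinct they are the vertices of a rectangle with sides $2|\operatorname{Re}z|$, $2|\operatorname{Im}z|$, whose aspect ratio is $\max(|\operatorname{Re}z|,|\operatorname{Im}z|)/\min(|\operatorname{Re}z|,|\operatorname{Im}z|)$. Let $\Gamma>0$ and consider Newton's equations $$\Gamma\dot q=p,\qquad \dot p=\nabla U(q),\qquad U(z)=-\sum_{g\in D_2\setminus\{1\}}\log|z-gz| ,$$ with energy $H(q,p)=\frac{1}{2\Gamma}|p|^2-U(q)$. A simultaneous binary collision of the pairs $\{h,hg\}$, $h\in D_2$ ($g\ne1$), is a configuration in which the vortices of each of these pairs coincide and no other vortices do. A generalized (transmission) solution on $[0,T]$ consists of a finite set $Y\subset(0,T)$, a continuous $q:[0,T]\to\mathbb C$ and a $p$ defined on $[0,T]\setminus Y$ such that, off $Y$, the four vortices are distinct, Newton's equations hold and $H(q,p)$ has one constant value, while at each $\sigma\in Y$ there is a simultaneous binary collision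 of the pairs $\{h,hg\}$, for some $g\neq 1$, continued by transmission: the relative position $q-gq$ of the colliding vortices passes through $0$ to the opposite side (that is, $\langle (q-gq)(\sigma+s),(q-gq)(\sigma-s)\rangle<0$ for all small $s>0$), and the momentum $p+gp$ of the centre of the pair has a limit as $t\to\sigma$. **Theorem.** Let $\Gamma>0$. For every $n\in\mathbb N$ and every $P\ge0$ there is an $R$ such that the following holds for every collision-free initial configuration $z_0$ (a rectangle of any size) with aspect ratio at least $R$ and every initial momentum $p_0$ with $|p_0|\le P$. There is a $g\in D_2\setminus\{1\}$ such that the pairs of closest vortices in the initial configuration are exactly the pairs $\{h,hg\}$, and there is a $T>0$ such that a generalized solution on $[0,T]$ with $q(0)=z_0$, $p(0)=p_0$ exists, and every such generalized solution passes in $(0,T)$ through at least $n$ simultaneous binary collisions, each of which is a collision of these pairs of closest vortices. -/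

import Mathlib

open Filter Topology

noncomputable section

namespace DihedralVortex

/-- The action of the Klein group `D₂` on the plane `ℂ ≅ ℝ²`: `r i` acts as the
rotation `z ↦ (-1)^i z` and `sr i` as the reflection `z ↦ (-1)^i conj z`. -/
def act : DihedralGroup 2 → ℂ → ℂ
  | .r i, z => if i = 0 then z else -z
  | .sr i, z => if i = 0 then (starRingEnd ℂ) z else -(starRingEnd ℂ) z

theorem act_one (z : ℂ) : act 1 z = z := rfl

/-- `act` is a group action. -/
theorem act_mul (g h : DihedralGroup 2) (z : ℂ) : act (g * h) z = act g (act h z) := by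
  have key : ∀ i : ZMod 2, i = 0 ∨ i = 1 := by decide
  rcases g with i | i <;> rcases h with j | j <;> rcases key i with rfl | rfl <;>
    rcases key j with rfl | rfl <;>
    simp [act_one, show (1 : ZMod 2) + 1 = 0 by decide] <;> simp [act]

/-- The four vortices of the dihedral configuration generated by `z` are `act g z`, `g ∈ D₂`,
that is `z, -z, conj z, -conj z`. The configuration is collision free if they are distinct; it
then consists of the vertices of a rectangle with sides `2 * |z.re|` and `2 * |z.im|`. -/
def CollisionFree (z : ℂ) : Prop :=
  Function.Injective fun g : DihedralGroup 2 => act g z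

/-- Long side over short side of the rectangle with vertices `act g z`. -/
def aspectRatio (z : ℂ) : ℝ :=
  max |z.re| |z.im| / min |z.re| |z.im|

/-- The pairs of closest vortices are exactly the pairs `{h, h * g}`, `h ∈ D₂`. -/
def ClosestPairs (g : DihedralGroup 2) (z : ℂ) : Prop :=
  g ≠ 1 ∧ ∀ h k : DihedralGroup 2, k ≠ h → k ≠ h * g →
    ∀ j, ‖act j z - act (j * g) z‖ < ‖act h z - act k z‖

/-- Simultaneous binary collision of the pairs `{h, h * g}`, `h ∈ D₂`: these vortices coincide,
and no others do (so it is not a total collapse). -/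
def BinaryCollision (g : DihedralGroup 2) (z : ℂ) : Prop :=
  g ≠ 1 ∧ ∀ h k : DihedralGroup 2, act h z = act k z ↔ k = h ∨ k = h * g

/-- The logarithmic dihedral potential. -/
def U (z : ℂ) : ℝ :=
  - ∑ g ∈ Finset.univ.erase (1 : DihedralGroup 2), Real.log ‖z - act g z‖

/-- The Hamiltonian `½ Γ⁻¹ |p|² - U(q)`. -/
def H (Γ : ℝ) (q p : ℂ) : ℝ :=
  (1 / 2) * Γ⁻¹ * ‖p‖ ^ 2 - U q

/-- `(q, p)` passes by transmission through a simultaneous binary collision of the pairs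
`{h, h * g}` at time `σ`: the relative position `q - g q` of the two vortices of a pair crosses the
origin to the opposite side, and the momentum of the centre of the pair is continuous.
Together with conservation of the total energy across `σ` (required in
`IsGeneralizedSolution`) this determines the continuation; for a one-centre problem it is
the continuation `q (σ + s) = - q (σ - s)`. -/
structure IsTransmission (g : DihedralGroup 2) (q p : ℝ → ℂ) (σ : ℝ) : Prop where
  collision : BinaryCollision g (q σ)
  crosses : ∀ᶠ s in 𝓝[>] (0 : ℝ),
    inner ℝ (q (σ + s) - act g (q (σ + s))) (q (σ - s) - act g (q (σ - s))) < 0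
  centre : ∃ c : ℂ, Tendsto (fun t => p t + act g (p t)) (𝓝[≠] σ) (𝓝 c)

/-- Generalized solution on the time interval `[0, T]` with the finite set `Y` of collision times:
`q` is continuous, it is a classical collision-free solution of `Γ q' = p`, `p' = ∇U(q)` of
constant energy off `Y`, and at the times in `Y` it goes through a simultaneous binary collision
by transmission. The value of `p` at the times in `Y` is irrelevant. -/
structure IsGeneralizedSolution (Γ T : ℝ) (Y : Finset ℝ) (q p : ℝ → ℂ) : Prop where
  times : ∀ σ ∈ Y, σ ∈ Set.Ioo 0 T
  cont : ContinuousOn q (Set.Icc 0 T)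
  free : ∀ t ∈ Set.Icc 0 T, t ∉ Y → CollisionFree (q t)
  position : ∀ t ∈ Set.Icc 0 T, t ∉ Y →
    HasDerivWithinAt q (Γ⁻¹ • p t) (Set.Icc 0 T) t
  momentum : ∀ t ∈ Set.Icc 0 T, t ∉ Y →
    HasDerivWithinAt p (gradient U (q t)) (Set.Icc 0 T) t
  energy : ∃ h : ℝ, ∀ t ∈ Set.Icc 0 T, t ∉ Y → H Γ (q t) (p t) = h
  transmission : ∀ σ ∈ Y, ∃ g, IsTransmission g q p σ

end DihedralVortex

end

/-! ### Reduction to the Cartesian coordinates of one vortex. -/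

namespace DihedralVortex

/-! Write the vortex as `x + iy`. Up to a constant the potential is `-(log|x| + log|y| + log|z|)`,
and the system is symmetric under exchanging `x` and `y`, so a rectangle long in the `x` direction
may be assumed. Two independent arguments are then run on a common time interval `[0, T]`, with `T`
of order `|y 0|` and small compared with `|x 0|`.

A priori estimates hold for every generalized solution. Away from `x = 0` the force on `x` is
bounded and `px` has a limit at each collision, so `x` stays near `x 0` and only `y = 0` collisions
can occur (`CoordSol.abs_x_sub_lt`). Conservation of energy then bounds `|y|` by a constant multiple
of `|y 0|` (`CoordSol.abs_y_le`). Between collisions `|y|` is positive and uniformly concave, so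
gaps are at most a constant multiple of `|y 0|` (`CoordSol.gap_le`). A long enough `T`, in units of
`|y 0|`, therefore forces many collisions.

Existence comes from regularization. In the amplitude-angle variables `y = η * exp e * sin φ`, `py =
γ * angleMomentum φ`, where `Γ = γ ^ 2`, the quantity `e + log η` is the energy of the transverse
logarithmic oscillator. With `φ` as independent variable the equations have no singularity at `sin φ
= 0`, and their right-hand side is `η` times a bounded field. Picard-Lindelöf thus yields a solution
over many half-turns once `η = |y 0| / |x 0|` is small (`exists_angularSol`). Time is strictly
increasing in `φ`; inverting it gives a generalized solution, and transmission is the sign change of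
`sin` at its zeros (`AngularSol.exists_coordSol`).

The bound `timeSpeed ≥ (η * γ / 4) * sin² φ` makes `T` at least a fixed multiple of `N * |y 0|`
after `N` half-turns, which links the two arguments. -/

theorem dihedral_two_cases (g : DihedralGroup 2) :
    g = 1 ∨ g = .r 1 ∨ g = .sr 0 ∨ g = .sr 1 := by
  revert g; decide

theorem act_r_zero (z : ℂ) : act (.r 0) z = z := rfl
theorem act_r_one (z : ℂ) : act (.r 1) z = -z := by simp [act]
theorem act_sr_zero (z : ℂ) : act (.sr 0) z = (starRingEnd ℂ) z := by simp [act]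
theorem act_sr_one (z : ℂ) : act (.sr 1) z = -(starRingEnd ℂ) z := by simp [act]

theorem collisionFree_iff (z : ℂ) : CollisionFree z ↔ z.re ≠ 0 ∧ z.im ≠ 0 := by
  constructor
  · intro h
    refine ⟨fun hz => ?_, fun hz => ?_⟩
    · have := @h (.sr 1) (.r 0) (by
        simp only [act_sr_one, act_r_zero]
        apply Complex.ext <;> simp [hz])
      exact absurd this (by decide)
    · have := @h (.sr 0) (.r 0) (by
        simp only [act_sr_zero, act_r_zero]
        apply Complex.ext <;> simp [hz])
      exact absurd this (by decide)
  · rintro ⟨hx, hy⟩ g h hgh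
    have hx' : z.re ≠ -z.re := fun h => hx (by linarith)
    have hy' : z.im ≠ -z.im := fun h => hy (by linarith)
    have hx'' : -z.re ≠ z.re := fun h => hx (by linarith)
    have hy'' : -z.im ≠ z.im := fun h => hy (by linarith)
    rcases dihedral_two_cases g with rfl | rfl | rfl | rfl <;>
    rcases dihedral_two_cases h with rfl | rfl | rfl | rfl <;>
    simp_all [act_sr_zero, act_sr_one, act_one, act_r_one, Complex.ext_iff]

theorem binaryCollision_sr_zero_iff (z : ℂ) :
    BinaryCollision (.sr 0) z ↔ z.im = 0 ∧ z.re ≠ 0 := by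
  constructor
  · rintro ⟨-, h⟩
    have h1 := (h (.r 0) (.sr 0)).2 (Or.inr (by decide))
    have h2 := mt (h (.r 0) (.sr 1)).1 (by decide)
    simp only [act_r_zero, act_sr_zero, act_sr_one, Complex.ext_iff, Complex.conj_re,
      Complex.conj_im, Complex.neg_re, Complex.neg_im, neg_neg, and_true] at h1 h2
    exact ⟨by linarith [h1.2], fun h => h2 (by linarith)⟩
  · rintro ⟨hy, hx⟩
    refine ⟨by decide, fun h k => ?_⟩
    have hx' : z.re ≠ -z.re := fun h => hx (by linarith)
    have hx'' : -z.re ≠ z.re := fun h => hx (by linarith)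
    rcases dihedral_two_cases h with rfl | rfl | rfl | rfl <;>
    rcases dihedral_two_cases k with rfl | rfl | rfl | rfl <;>
    simp [hy, hx', hx'', act_sr_zero, act_sr_one, act_one, act_r_one, Complex.ext_iff] <;>
    decide

theorem binaryCollision_sr_one_iff (z : ℂ) :
    BinaryCollision (.sr 1) z ↔ z.re = 0 ∧ z.im ≠ 0 := by
  constructor
  · rintro ⟨-, h⟩
    have h1 := (h (.r 0) (.sr 1)).2 (Or.inr (by decide))
    have h2 := mt (h (.r 0) (.sr 0)).1 (by decide)
    simp only [act_r_zero, act_sr_zero, act_sr_one, Complex.ext_iff, Complex.conj_re,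
      Complex.conj_im, Complex.neg_re, Complex.neg_im, neg_neg, true_and] at h1 h2
    exact ⟨by linarith [h1.1], fun h => h2 (by linarith)⟩
  · rintro ⟨hx, hy⟩
    refine ⟨by decide, fun h k => ?_⟩
    have hy' : z.im ≠ -z.im := fun h => hy (by linarith)
    have hy'' : -z.im ≠ z.im := fun h => hy (by linarith)
    rcases dihedral_two_cases h with rfl | rfl | rfl | rfl <;>
    rcases dihedral_two_cases k with rfl | rfl | rfl | rfl <;>
    simp [hx, hy', hy'', act_sr_zero, act_sr_one, act_one, act_r_one, Complex.ext_iff] <;>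
    decide

/-- If `z = -z` then `z = 0`, where all four vortices meet; so the rotation never produces a binary
collision. -/
theorem binaryCollision_cases {g : DihedralGroup 2} {z : ℂ} (h : BinaryCollision g z) :
    g = .sr 0 ∨ g = .sr 1 := by
  rcases dihedral_two_cases g with rfl | rfl | rfl | rfl
  · exact absurd rfl h.1
  · have h1 := (h.2 (.r 0) (.r 1)).2 (Or.inr (by decide))
    have h2 := mt (h.2 (.r 0) (.sr 0)).1 (by decide)
    simp only [act_r_zero, act_r_one, act_sr_zero, Complex.ext_iff, Complex.conj_re,
      Complex.conj_im, Complex.neg_re, Complex.neg_im, true_and] at h1 h2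
    exact absurd h1.2 h2
  · exact Or.inl rfl
  · exact Or.inr rfl

theorem sum_erase_one (f : DihedralGroup 2 → ℝ) :
    ∑ g ∈ Finset.univ.erase (1 : DihedralGroup 2), f g = f (.r 1) + f (.sr 0) + f (.sr 1) := by
  have : Finset.univ.erase (1 : DihedralGroup 2) = {.r 1, .sr 0, .sr 1} := by decide
  rw [this, Finset.sum_insert (by decide), Finset.sum_insert (by decide), Finset.sum_singleton]
  ring

/-- `Real.log` ignores signs, so the absolute values in the distances `|2x|` and `|2y|` can be
dropped. -/
theorem U_eq (z : ℂ) :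
    U z = -(Real.log (4 * (z.re ^ 2 + z.im ^ 2)) / 2 + Real.log (2 * z.im)
      + Real.log (2 * z.re)) := by
  have h1 : ‖z - act (.r 1) z‖ = √(4 * (z.re ^ 2 + z.im ^ 2)) := by
    rw [act_r_one, Complex.norm_eq_sqrt_sq_add_sq]; congr 1; simp; ring
  have h2 : ‖z - act (.sr 0) z‖ = |2 * z.im| := by
    rw [act_sr_zero, Complex.norm_eq_sqrt_sq_add_sq, ← Real.sqrt_sq_eq_abs]; simp; ring_nf
  have h3 : ‖z - act (.sr 1) z‖ = |2 * z.re| := by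
    rw [act_sr_one, Complex.norm_eq_sqrt_sq_add_sq, ← Real.sqrt_sq_eq_abs]; simp; ring_nf
  rw [U, sum_erase_one, h1, h2, h3, Real.log_abs, Real.log_abs, Real.log_sqrt (by positivity)]

theorem gradient_U {z : ℂ} (hx : z.re ≠ 0) (hy : z.im ≠ 0) :
    gradient U z = ⟨-(1 / z.re + z.re / (z.re ^ 2 + z.im ^ 2)),
      -(1 / z.im + z.im / (z.re ^ 2 + z.im ^ 2))⟩ := by
  apply HasGradientAt.gradient
  rw [hasGradientAt_iff_hasFDerivAt]
  have hU : U = fun z : ℂ => -(Real.log (4 * (z.re ^ 2 + z.im ^ 2)) / 2 + Real.log (2 * z.im)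
      + Real.log (2 * z.re)) := funext U_eq
  rw [hU]
  have hre : HasFDerivAt (fun z : ℂ => z.re) Complex.reCLM z := Complex.reCLM.hasFDerivAt
  have him : HasFDerivAt (fun z : ℂ => z.im) Complex.imCLM z := Complex.imCLM.hasFDerivAt
  have hpos : 0 < z.re ^ 2 + z.im ^ 2 := by positivity
  have := (((((hre.pow 2).add (him.pow 2)).const_mul 4).log (by positivity)).mul_const
    (1 / 2 : ℝ)).add ((him.const_mul 2).log (by positivity)) |>.add
      ((hre.const_mul 2).log (by positivity)) |>.neg
  refine HasFDerivAt.congr_fderiv (this.congr_of_eventuallyEq ?_) ?_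
  · refine Eventually.of_forall fun w => ?_
    simp [div_eq_mul_inv]
  · ext w
    simp [Complex.inner, Complex.mul_re]
    field_simp
    ring

theorem H_eq (Γ : ℝ) {q p : ℂ} (hx : q.re ≠ 0) (hy : q.im ≠ 0) :
    H Γ q p = (p.re ^ 2 + p.im ^ 2) / (2 * Γ) + Real.log q.re + Real.log q.im
      + Real.log (q.re ^ 2 + q.im ^ 2) / 2 + (Real.log 4 / 2 + 2 * Real.log 2) := by
  have hpos : 0 < q.re ^ 2 + q.im ^ 2 := by positivity
  rw [H, U_eq, Real.log_mul (by norm_num) hpos.ne', Real.log_mul (by norm_num) hx,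
    Real.log_mul (by norm_num) hy, ← Complex.normSq_eq_norm_sq, Complex.normSq_apply]
  ring

/-- Passage of the coordinate `a` through `0`, where the momentum `b` conjugate to the other
coordinate has a limit. -/
structure Crosses (a b : ℝ → ℝ) (σ : ℝ) : Prop where
  changes_sign : ∀ᶠ s in 𝓝[>] (0 : ℝ), a (σ + s) * a (σ - s) < 0
  limit : ∃ c : ℝ, Tendsto b (𝓝[≠] σ) (𝓝 c)

/-- Generalized solutions in Cartesian coordinates. -/
structure CoordSol (Γ T : ℝ) (Y : Finset ℝ) (x y px py : ℝ → ℝ) : Prop where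
  times : ∀ σ ∈ Y, σ ∈ Set.Ioo 0 T
  cont_x : ContinuousOn x (Set.Icc 0 T)
  cont_y : ContinuousOn y (Set.Icc 0 T)
  free_x : ∀ t ∈ Set.Icc 0 T, t ∉ Y → x t ≠ 0
  free_y : ∀ t ∈ Set.Icc 0 T, t ∉ Y → y t ≠ 0
  deriv_x : ∀ t ∈ Set.Icc 0 T, t ∉ Y → HasDerivWithinAt x (Γ⁻¹ * px t) (Set.Icc 0 T) t
  deriv_y : ∀ t ∈ Set.Icc 0 T, t ∉ Y → HasDerivWithinAt y (Γ⁻¹ * py t) (Set.Icc 0 T) t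
  deriv_px : ∀ t ∈ Set.Icc 0 T, t ∉ Y →
    HasDerivWithinAt px (-(1 / x t + x t / (x t ^ 2 + y t ^ 2))) (Set.Icc 0 T) t
  deriv_py : ∀ t ∈ Set.Icc 0 T, t ∉ Y →
    HasDerivWithinAt py (-(1 / y t + y t / (x t ^ 2 + y t ^ 2))) (Set.Icc 0 T) t
  energy : ∃ h : ℝ, ∀ t ∈ Set.Icc 0 T, t ∉ Y →
    (px t ^ 2 + py t ^ 2) / (2 * Γ) + Real.log (x t) + Real.log (y t)
      + Real.log (x t ^ 2 + y t ^ 2) / 2 = h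
  collision : ∀ σ ∈ Y, (y σ = 0 ∧ x σ ≠ 0 ∧ Crosses y px σ) ∨ (x σ = 0 ∧ y σ ≠ 0 ∧ Crosses x py σ)

/-- Reflection in the diagonal is a symmetry of the system; it reduces tall rectangles to wide ones.
-/
theorem CoordSol.swap {Γ T : ℝ} {Y : Finset ℝ} {x y px py : ℝ → ℝ}
    (h : CoordSol Γ T Y x y px py) : CoordSol Γ T Y y x py px where
  times := h.times
  cont_x := h.cont_y
  cont_y := h.cont_x
  free_x := h.free_y
  free_y := h.free_x
  deriv_x := h.deriv_y
  deriv_y := h.deriv_x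
  deriv_px t ht hY := by simpa only [add_comm] using h.deriv_py t ht hY
  deriv_py t ht hY := by simpa only [add_comm] using h.deriv_px t ht hY
  energy := by
    obtain ⟨E, hE⟩ := h.energy
    refine ⟨E, fun t ht hY => ?_⟩
    rw [← hE t ht hY, add_comm (y t ^ 2), add_comm (py t ^ 2)]
    ring
  collision σ hσ := (h.collision σ hσ).symm

theorem hasDerivWithinAt_complex_iff {f : ℝ → ℂ} {v : ℂ} {s : Set ℝ} {t : ℝ} :
    HasDerivWithinAt f v s t ↔ HasDerivWithinAt (fun t => (f t).re) v.re s t ∧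
      HasDerivWithinAt (fun t => (f t).im) v.im s t := by
  constructor
  · intro h
    exact ⟨(Complex.reCLM.hasFDerivAt (x := f t)).comp_hasDerivWithinAt t h,
      (Complex.imCLM.hasFDerivAt (x := f t)).comp_hasDerivWithinAt t h⟩
  · rintro ⟨h1, h2⟩
    have := h1.ofReal_comp.add (h2.ofReal_comp.mul_const Complex.I)
    simpa [Complex.re_add_im, Pi.add_def] using this

/-- Since `p + conj p = 2 * re p`, the momentum of the centre of a colliding pair is the
longitudinal momentum. -/
theorem tendsto_re_add_act_iff {p : ℝ → ℂ} {σ : ℝ} :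
    (∃ c : ℂ, Tendsto (fun t => p t + act (.sr 0) (p t)) (𝓝[≠] σ) (𝓝 c)) ↔
      ∃ c : ℝ, Tendsto (fun t => (p t).re) (𝓝[≠] σ) (𝓝 c) := by
  constructor
  · rintro ⟨c, hc⟩
    refine ⟨c.re / 2, ?_⟩
    refine (((Complex.continuous_re.tendsto c).comp hc).div_const 2).congr fun t => ?_
    simp [act_sr_zero]
  · rintro ⟨c, hc⟩
    refine ⟨((2 * c : ℝ) : ℂ), ?_⟩
    refine ((Complex.continuous_ofReal.tendsto _).comp (hc.const_mul 2)).congr fun t => ?_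
    rw [act_sr_zero]
    apply Complex.ext <;> simp
    ring

theorem tendsto_im_add_act_iff {p : ℝ → ℂ} {σ : ℝ} :
    (∃ c : ℂ, Tendsto (fun t => p t + act (.sr 1) (p t)) (𝓝[≠] σ) (𝓝 c)) ↔
      ∃ c : ℝ, Tendsto (fun t => (p t).im) (𝓝[≠] σ) (𝓝 c) := by
  constructor
  · rintro ⟨c, hc⟩
    refine ⟨c.im / 2, ?_⟩
    refine (((Complex.continuous_im.tendsto c).comp hc).div_const 2).congr fun t => ?_
    simp [act_sr_one]
  · rintro ⟨c, hc⟩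
    refine ⟨((2 * c : ℝ) : ℂ) * Complex.I, ?_⟩
    refine (((Complex.continuous_ofReal.tendsto _).comp
      (hc.const_mul 2)).mul_const Complex.I).congr fun t => ?_
    rw [act_sr_one]
    apply Complex.ext <;> simp
    ring

theorem inner_sub_act_sr_zero (z w : ℂ) :
    inner ℝ (z - act (.sr 0) z) (w - act (.sr 0) w) = 4 * (z.im * w.im) := by
  simp [act_sr_zero, Complex.inner, Complex.mul_re]
  ring

theorem inner_sub_act_sr_one (z w : ℂ) :
    inner ℝ (z - act (.sr 1) z) (w - act (.sr 1) w) = 4 * (z.re * w.re) := by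
  simp [act_sr_one, Complex.inner, Complex.mul_re]
  ring

theorem isTransmission_sr_zero_iff {q p : ℝ → ℂ} {σ : ℝ} :
    IsTransmission (.sr 0) q p σ ↔ (q σ).im = 0 ∧ (q σ).re ≠ 0 ∧
      Crosses (fun t => (q t).im) (fun t => (p t).re) σ := by
  have key : ∀ a : ℝ, 4 * a < 0 ↔ a < 0 := fun a => by constructor <;> intro <;> linarith
  constructor
  · rintro ⟨h1, h2, h3⟩
    simp only [inner_sub_act_sr_zero, key] at h2
    exact ⟨((binaryCollision_sr_zero_iff _).1 h1).1, ((binaryCollision_sr_zero_iff _).1 h1).2,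
      h2, tendsto_re_add_act_iff.1 h3⟩
  · rintro ⟨h1, h1', h2, h3⟩
    refine ⟨(binaryCollision_sr_zero_iff _).2 ⟨h1, h1'⟩, ?_, tendsto_re_add_act_iff.2 h3⟩
    simpa only [inner_sub_act_sr_zero, key] using h2

theorem isTransmission_sr_one_iff {q p : ℝ → ℂ} {σ : ℝ} :
    IsTransmission (.sr 1) q p σ ↔ (q σ).re = 0 ∧ (q σ).im ≠ 0 ∧
      Crosses (fun t => (q t).re) (fun t => (p t).im) σ := by
  have key : ∀ a : ℝ, 4 * a < 0 ↔ a < 0 := fun a => by constructor <;> intro <;> linarith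
  constructor
  · rintro ⟨h1, h2, h3⟩
    simp only [inner_sub_act_sr_one, key] at h2
    exact ⟨((binaryCollision_sr_one_iff _).1 h1).1, ((binaryCollision_sr_one_iff _).1 h1).2,
      h2, tendsto_im_add_act_iff.1 h3⟩
  · rintro ⟨h1, h1', h2, h3⟩
    refine ⟨(binaryCollision_sr_one_iff _).2 ⟨h1, h1'⟩, ?_, tendsto_im_add_act_iff.2 h3⟩
    simpa only [inner_sub_act_sr_one, key] using h2

theorem isGeneralizedSolution_iff {Γ T : ℝ} {Y : Finset ℝ} {q p : ℝ → ℂ} :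
    IsGeneralizedSolution Γ T Y q p ↔ CoordSol Γ T Y (fun t => (q t).re) (fun t => (q t).im)
      (fun t => (p t).re) (fun t => (p t).im) := by
  constructor
  · intro h
    have hf := fun t ht hY => (collisionFree_iff _).1 (h.free t ht hY)
    have hp := fun t ht hY => hasDerivWithinAt_complex_iff.1 (h.position t ht hY)
    have hm : ∀ t (ht : t ∈ Set.Icc 0 T) (hY : t ∉ Y), _ := fun t ht hY => by
      have := hasDerivWithinAt_complex_iff.1 (h.momentum t ht hY)
      rw [gradient_U (hf t ht hY).1 (hf t ht hY).2] at this
      exact this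
    simp only [Complex.smul_re, Complex.smul_im, smul_eq_mul] at hp
    refine ⟨h.times, Complex.continuous_re.comp_continuousOn h.cont,
      Complex.continuous_im.comp_continuousOn h.cont, fun t ht hY => (hf t ht hY).1,
      fun t ht hY => (hf t ht hY).2, fun t ht hY => (hp t ht hY).1,
      fun t ht hY => (hp t ht hY).2, fun t ht hY => (hm t ht hY).1,
      fun t ht hY => (hm t ht hY).2, ?_, ?_⟩
    · obtain ⟨E, hE⟩ := h.energy
      refine ⟨E - (Real.log 4 / 2 + 2 * Real.log 2), fun t ht hY => ?_⟩
      rw [← hE t ht hY, H_eq Γ (hf t ht hY).1 (hf t ht hY).2]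
      ring
    · intro σ hσ
      obtain ⟨g, hg⟩ := h.transmission σ hσ
      rcases binaryCollision_cases hg.collision with rfl | rfl
      · exact Or.inl (isTransmission_sr_zero_iff.1 hg)
      · exact Or.inr (isTransmission_sr_one_iff.1 hg)
  · intro h
    refine ⟨h.times, ?_, fun t ht hY => (collisionFree_iff _).2
      ⟨h.free_x t ht hY, h.free_y t ht hY⟩, fun t ht hY => ?_, fun t ht hY => ?_, ?_, ?_⟩
    · have := (Complex.continuous_ofReal.comp_continuousOn h.cont_x).add
        ((Complex.continuous_ofReal.comp_continuousOn h.cont_y).mul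
          (continuousOn_const (c := Complex.I)))
      refine this.congr fun t _ => ?_
      simp [Complex.re_add_im]
    · rw [hasDerivWithinAt_complex_iff]
      simpa using ⟨h.deriv_x t ht hY, h.deriv_y t ht hY⟩
    · rw [hasDerivWithinAt_complex_iff, gradient_U (h.free_x t ht hY) (h.free_y t ht hY)]
      exact ⟨h.deriv_px t ht hY, h.deriv_py t ht hY⟩
    · obtain ⟨E, hE⟩ := h.energy
      refine ⟨E + (Real.log 4 / 2 + 2 * Real.log 2), fun t ht hY => ?_⟩
      rw [← hE t ht hY, H_eq Γ (h.free_x t ht hY) (h.free_y t ht hY)]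
    · intro σ hσ
      rcases h.collision σ hσ with h | h
      · exact ⟨_, isTransmission_sr_zero_iff.2 h⟩
      · exact ⟨_, isTransmission_sr_one_iff.2 h⟩

theorem norm_sub_act_sr_zero (z : ℂ) : ‖z - (starRingEnd ℂ) z‖ = 2 * |z.im| := by
  have : z - (starRingEnd ℂ) z = ((2 * z.im : ℝ) : ℂ) * Complex.I := by
    apply Complex.ext <;> simp; ring
  rw [this]; simp

theorem norm_add_conj (z : ℂ) : ‖z + (starRingEnd ℂ) z‖ = 2 * |z.re| := by
  have : z + (starRingEnd ℂ) z = ((2 * z.re : ℝ) : ℂ) := by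
    apply Complex.ext <;> simp; ring
  rw [this, Complex.norm_real]; simp

theorem norm_act (g : DihedralGroup 2) (z : ℂ) : ‖act g z‖ = ‖z‖ := by
  rcases dihedral_two_cases g with rfl | rfl | rfl | rfl <;>
  simp [act_sr_zero, act_sr_one, act_one, act_r_one]

theorem act_sub (g : DihedralGroup 2) (z w : ℂ) : act g (z - w) = act g z - act g w := by
  rcases dihedral_two_cases g with rfl | rfl | rfl | rfl <;>
  simp [act_sr_zero, act_sr_one, act_one, act_r_one] <;> ring_nf

theorem norm_act_sub_act_mul (h g : DihedralGroup 2) (z : ℂ) :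
    ‖act h z - act (h * g) z‖ = ‖z - act g z‖ := by
  rw [act_mul, ← act_sub, norm_act]

/-- The group acts by isometries, so the distance between vortices `h` and `k` depends only on `h⁻¹
* k`. -/
theorem closestPairs_of_forall {g : DihedralGroup 2} (hg : g ≠ 1) {z : ℂ}
    (h : ∀ k, k ≠ 1 → k ≠ g → ‖z - act g z‖ < ‖z - act k z‖) : ClosestPairs g z := by
  refine ⟨hg, fun a b h1 h2 j => ?_⟩
  have hb : b = a * (a⁻¹ * b) := by group
  rw [norm_act_sub_act_mul, hb, norm_act_sub_act_mul]
  refine h _ (fun h => h1 ?_) (fun h => h2 ?_)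
  · rw [hb, h, mul_one]
  · rw [hb, h]

theorem two_mul_abs_lt_norm_add_self {z : ℂ} (hx : z.re ≠ 0) (hy : z.im ≠ 0) :
    2 * |z.im| < ‖z + z‖ ∧ 2 * |z.re| < ‖z + z‖ := by
  have h : ‖z + z‖ = 2 * ‖z‖ := by rw [← two_mul, norm_mul]; simp
  rw [h]
  exact ⟨by linarith [Complex.abs_im_lt_norm.2 hx], by linarith [Complex.abs_re_lt_norm.2 hy]⟩

theorem closestPairs_sr_zero {z : ℂ} (hx : z.re ≠ 0) (hy : z.im ≠ 0) (h : |z.im| < |z.re|) :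
    ClosestPairs (.sr 0) z := by
  refine closestPairs_of_forall (by decide) fun k hk hk' => ?_
  rcases dihedral_two_cases k with rfl | rfl | rfl | rfl
  · exact absurd rfl hk
  · simpa [act_sr_zero, act_r_one, norm_sub_act_sr_zero] using
      (two_mul_abs_lt_norm_add_self hx hy).1
  · exact absurd rfl hk'
  · simpa [act_sr_zero, act_sr_one, norm_sub_act_sr_zero, norm_add_conj] using h

theorem closestPairs_sr_one {z : ℂ} (hx : z.re ≠ 0) (hy : z.im ≠ 0) (h : |z.re| < |z.im|) :
    ClosestPairs (.sr 1) z := by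
  refine closestPairs_of_forall (by decide) fun k hk hk' => ?_
  rcases dihedral_two_cases k with rfl | rfl | rfl | rfl
  · exact absurd rfl hk
  · simpa [act_sr_one, act_r_one, norm_add_conj] using
      (two_mul_abs_lt_norm_add_self hx hy).2
  · simpa [act_sr_zero, act_sr_one, norm_sub_act_sr_zero, norm_add_conj] using h
  · exact absurd rfl hk'

end DihedralVortex

/-! ### A priori estimates for arbitrary generalized solutions. -/

namespace DihedralVortex

/-- Continuity at an exceptional point allows the mean value estimates on its two sides to be added.
-/
theorem abs_sub_le_of_hasDerivAt_off_finset {f : ℝ → ℝ} {C : ℝ} (Y : Finset ℝ) :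
    ∀ {a b : ℝ}, a ≤ b → ContinuousOn f (Set.Icc a b) →
      (∀ t ∈ Set.Ioo a b, t ∉ Y → ∃ v, HasDerivAt f v t ∧ |v| ≤ C) →
      |f b - f a| ≤ C * (b - a) := by
  induction Y using Finset.induction_on with
  | empty =>
    intro a b hab hf hd
    rcases hab.eq_or_lt with rfl | hlt
    · simp
    · choose! v hv using hd
      obtain ⟨c, hc, h⟩ := exists_hasDerivAt_eq_slope f v hlt hf
        fun t ht => (hv t ht (by simp)).1
      have hv' := (hv c hc (by simp)).2
      rw [h, abs_div, abs_of_pos (sub_pos.2 hlt), div_le_iff₀ (sub_pos.2 hlt)] at hv'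
      exact hv'
  | insert σ Y _ ih =>
    intro a b hab hf hd
    by_cases hσ : σ ∈ Set.Ioo a b
    · have h1 := ih hσ.1.le (hf.mono (Set.Icc_subset_Icc_right hσ.2.le)) fun t ht hY =>
        hd t ⟨ht.1, ht.2.trans hσ.2⟩ (by simp [hY, ht.2.ne])
      have h2 := ih hσ.2.le (hf.mono (Set.Icc_subset_Icc_left hσ.1.le)) fun t ht hY =>
        hd t ⟨hσ.1.trans ht.1, ht.2⟩ (by simp [hY, ht.1.ne'])
      have := abs_add_le (f b - f σ) (f σ - f a)
      rw [sub_add_sub_cancel] at this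
      linarith
    · refine ih hab hf fun t ht hY => hd t ht ?_
      have : t ≠ σ := by rintro rfl; exact hσ ht
      simp [hY, this]

theorem length_le_of_gaps_le {ℓ : ℝ} (Y : Finset ℝ) :
    ∀ {a b : ℝ}, a ≤ b → (∀ c d, a ≤ c → c ≤ d → d ≤ b → (∀ t ∈ Set.Ioo c d, t ∉ Y) → d - c ≤ ℓ) →
      b - a ≤ (Y.card + 1) * ℓ := by
  induction Y using Finset.induction_on_max with
  | empty =>
    intro a b hab h
    simpa using h a b le_rfl hab le_rfl (by simp)
  | insert σ Y hσ ih =>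
    intro a b hab h
    -- The degenerate gap `c = d = a` already forces `ℓ` to be nonnegative.
    have hℓ : 0 ≤ ℓ := by simpa using h a a le_rfl le_rfl hab (by simp)
    rw [Finset.card_insert_of_notMem fun h => (hσ σ h).false]
    push_cast
    by_cases hab' : σ ∈ Set.Ioo a b
    · have h1 := ih hab'.1.le fun c d hc hcd hd hY =>
        h c d hc hcd (hd.trans hab'.2.le) fun t ht => by
          simp [hY t ht, (ht.2.trans_le hd).ne]
      have h2 := h σ b hab'.1.le hab'.2.le le_rfl fun t ht => by
        have : t ∉ Y := fun h => (hσ t h).not_gt ht.1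
        simp [this, ht.1.ne']
      linarith
    · have h1 := ih hab fun c d hc hcd hd hY => h c d hc hcd hd fun t ht => by
        have : t ≠ σ := by rintro rfl; exact hab' ⟨hc.trans_lt ht.1, ht.2.trans_le hd⟩
        simp [hY t ht, this]
      linarith

/-- A positive function with second derivative at most `-m` lives on a short interval. -/
theorem mul_sq_length_le {f v w : ℝ → ℝ} {a b m B : ℝ} (hab : a < b)
    (hf : ContinuousOn f (Set.Icc a b)) (hpos : ∀ t ∈ Set.Ioo a b, 0 < f t)
    (hB : ∀ t ∈ Set.Ioo a b, f t ≤ B) (hv : ∀ t ∈ Set.Ioo a b, HasDerivAt f (v t) t)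
    (hw : ∀ t ∈ Set.Ioo a b, HasDerivAt v (w t) t) (hm : ∀ t ∈ Set.Ioo a b, w t ≤ -m) :
    m * (b - a) ^ 2 ≤ 8 * B := by
  have hmid : (a + b) / 2 ∈ Set.Ioo a b := ⟨by linarith, by linarith⟩
  -- Adding the parabola `m (t - mid)² / 2` keeps the function concave. Comparing the midpoint with
  -- the endpoints gives `f mid ≥ m (b - a)² / 8`.
  have hconc : ConcaveOn ℝ (Set.Icc a b) fun t => f t + m * (t - (a + b) / 2) ^ 2 / 2 := by
    refine concaveOn_of_hasDerivWithinAt2_nonpos (convex_Icc a b) (hf.add (by fun_prop))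
      (f' := fun t => v t + m * (t - (a + b) / 2)) (f'' := fun t => w t + m) ?_ ?_ ?_ <;>
    rw [interior_Icc]
    · intro t ht
      have := ((((hasDerivAt_id t).sub_const ((a + b) / 2)).pow 2).const_mul m).div_const 2
      refine ((hv t ht).add this).hasDerivWithinAt.congr_deriv ?_
      simp; ring
    · intro t ht
      have := ((hasDerivAt_id t).sub_const ((a + b) / 2)).const_mul m
      refine ((hw t ht).add this).hasDerivWithinAt.congr_deriv ?_
      simp
    · intro t ht
      linarith [hm t ht]
  have hcl : ∀ t ∈ Set.Icc a b, 0 ≤ f t := by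
    rw [← closure_Ioo hab.ne]
    refine closure_minimal (t := {t | t ∈ Set.Icc a b ∧ 0 ≤ f t}) (fun t ht =>
      ⟨Set.Ioo_subset_Icc_self ht, (hpos t ht).le⟩) ?_ |>.trans fun t ht => ht.2
    exact hf.preimage_isClosed_of_isClosed isClosed_Icc isClosed_Ici
  have h := hconc.2 (Set.left_mem_Icc.2 hab.le) (Set.right_mem_Icc.2 hab.le)
    (show (0 : ℝ) ≤ 1 / 2 by norm_num) (show (0 : ℝ) ≤ 1 / 2 by norm_num) (by norm_num)
  simp only [smul_eq_mul] at h
  rw [show 1 / 2 * a + 1 / 2 * b = (a + b) / 2 by ring] at h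
  have h1 := hcl a (Set.left_mem_Icc.2 hab.le)
  have h2 := hcl b (Set.right_mem_Icc.2 hab.le)
  have h3 := hB _ hmid
  nlinarith

namespace CoordSol

variable {Γ T : ℝ} {Y : Finset ℝ} {x y px py : ℝ → ℝ}

theorem zero_notMem (h : CoordSol Γ T Y x y px py) : (0 : ℝ) ∉ Y :=
  fun h0 => (h.times 0 h0).1.false

/-- As long as `x` is near its initial value, its momentum varies slowly. -/
theorem abs_px_sub_le (h : CoordSol Γ T Y x y px py) (hx0 : x 0 ≠ 0) {b : ℝ} (hb : b ≤ T)
    (hx : ∀ t ∈ Set.Ico 0 b, |x t - x 0| < |x 0| / 2) {t : ℝ} (ht : t ∈ Set.Ico 0 b)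
    (htY : t ∉ Y) : |px t - px 0| ≤ 4 / |x 0| * t := by
  classical
  have hX : 0 < |x 0| := abs_pos.2 hx0
  have hxl : ∀ τ ∈ Set.Ico 0 b, |x 0| / 2 < |x τ| := fun τ hτ => by
    have := abs_sub_abs_le_abs_sub (x 0) (x τ)
    rw [abs_sub_comm (x 0)] at this
    linarith [hx τ hτ]
  have hcross : ∀ σ ∈ Y, σ ∈ Set.Ico 0 b → ∃ c : ℝ, Tendsto px (𝓝[≠] σ) (𝓝 c) := fun σ hσ hσb => by
    rcases h.collision σ hσ with ⟨-, -, hc⟩ | ⟨h0, -⟩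
    · exact hc.limit
    · have := hxl σ hσb
      rw [h0, abs_zero] at this
      linarith
  choose! c hc using hcross
  -- The values of `px` at collision times are arbitrary; replacing them by the limits required by
  -- transmission gives a continuous function.
  let g : ℝ → ℝ := fun τ => if τ ∈ Y then c τ else px τ
  have hg : ∀ τ, τ ∉ Y → g =ᶠ[𝓝 τ] px := fun τ hτ => by
    filter_upwards [Y.finite_toSet.isClosed.isOpen_compl.mem_nhds (by simpa using hτ)] with s hs
    exact if_neg (by simpa using hs)
  have hg' : ∀ τ, g =ᶠ[𝓝[≠] τ] px := fun τ => by
    have hcl : IsOpen ((Y.erase τ : Set ℝ)ᶜ) := (Y.erase τ).finite_toSet.isClosed.isOpen_compl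
    filter_upwards [mem_nhdsWithin_of_mem_nhds (hcl.mem_nhds (by simp)),
      self_mem_nhdsWithin] with s hs hs'
    refine if_neg fun hY => hs ?_
    simpa using ⟨hY, hs'⟩
  have hsub : Set.Icc 0 t ⊆ Set.Icc 0 T := Set.Icc_subset_Icc_right (ht.2.le.trans hb)
  have hcont : ContinuousOn g (Set.Icc 0 t) := fun τ hτ => by
    by_cases hY : τ ∈ Y
    · have : ContinuousAt g τ := by
        rw [← continuousWithinAt_compl_self]
        have := (hc τ hY ⟨hτ.1, hτ.2.trans_lt ht.2⟩).congr' (hg' τ).symm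
        rwa [← show g τ = c τ from if_pos hY] at this
      exact this.continuousWithinAt
    · exact ((h.deriv_px τ (hsub hτ) hY).continuousWithinAt.mono hsub).congr_of_eventuallyEq
        ((hg τ hY).filter_mono nhdsWithin_le_nhds) (hg τ hY).self_of_nhds
  have key := abs_sub_le_of_hasDerivAt_off_finset (C := 4 / |x 0|) Y ht.1 hcont
    fun τ hτ hY => by
      have hτb : τ ∈ Set.Ico 0 b := ⟨hτ.1.le, hτ.2.trans ht.2⟩
      refine ⟨_, ((h.deriv_px τ ⟨hτ.1.le, hτb.2.le.trans hb⟩ hY).hasDerivAt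
        (Icc_mem_nhds hτ.1 (hτb.2.trans_le hb))).congr_of_eventuallyEq (hg τ hY), ?_⟩
      have h1 := hxl τ hτb
      have hxp : 0 < |x τ| := by linarith
      have h2 : |x τ / (x τ ^ 2 + y τ ^ 2)| ≤ 1 / |x τ| := by
        have : 0 < x τ ^ 2 + y τ ^ 2 := by have := abs_pos.1 hxp; positivity
        rw [abs_div, abs_of_pos this, div_le_div_iff₀ this hxp, ← sq, sq_abs]
        nlinarith [sq_nonneg (y τ)]
      have h3 : 1 / |x τ| ≤ 2 / |x 0| := by
        rw [div_le_div_iff₀ hxp hX]; linarith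
      rw [abs_neg]
      refine (abs_add_le _ _).trans ?_
      rw [abs_div, abs_one]
      have : 4 / |x 0| = 2 / |x 0| + 2 / |x 0| := by ring
      linarith
  rw [show g t = px t from if_neg htY, show g 0 = px 0 from if_neg h.zero_notMem, sub_zero] at key
  exact key

/-- For short times the long side of the rectangle does not change much. -/
theorem abs_x_sub_lt (h : CoordSol Γ T Y x y px py) (hΓ : 0 < Γ) (hx0 : x 0 ≠ 0)
    (h1 : 4 * T ≤ |x 0|) (h2 : (|px 0| + 1) * T < Γ * (|x 0| / 2)) :
    ∀ t ∈ Set.Icc 0 T, |x t - x 0| < |x 0| / 2 := by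
  by_contra! hne
  have hX : 0 < |x 0| := abs_pos.2 hx0
  -- Bootstrap: let `b` be the first time at which `x` has moved by half its size. Before `b` the
  -- momentum changes by at most `1`, so by time `b` the displacement is still too small.
  have hclosed : IsCompact {t | t ∈ Set.Icc 0 T ∧ |x 0| / 2 ≤ |x t - x 0|} :=
    isCompact_Icc.of_isClosed_subset
      ((h.cont_x.sub continuousOn_const).abs.preimage_isClosed_of_isClosed isClosed_Icc
        isClosed_Ici) fun t ht => ht.1
  obtain ⟨b, ⟨hbT, hb⟩, hmin⟩ := hclosed.exists_isLeast hne
  have hx : ∀ t ∈ Set.Ico 0 b, |x t - x 0| < |x 0| / 2 := fun t ht => by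
    by_contra! hlt
    exact ht.2.not_ge (hmin ⟨⟨ht.1, ht.2.le.trans hbT.2⟩, hlt⟩)
  have key := abs_sub_le_of_hasDerivAt_off_finset (C := Γ⁻¹ * (|px 0| + 1)) Y hbT.1
    (h.cont_x.mono (Set.Icc_subset_Icc_right hbT.2)) fun t ht hY => by
      have htT : t < T := ht.2.trans_le hbT.2
      refine ⟨_, (h.deriv_x t ⟨ht.1.le, htT.le⟩ hY).hasDerivAt (Icc_mem_nhds ht.1 htT), ?_⟩
      rw [abs_mul, abs_of_pos (inv_pos.2 hΓ)]
      have h3 := h.abs_px_sub_le hx0 hbT.2 hx ⟨ht.1.le, ht.2⟩ hY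
      have h4 : 4 / |x 0| * t ≤ 1 := by
        rw [div_mul_eq_mul_div, div_le_one hX]; linarith
      have := abs_sub_abs_le_abs_sub (px t) (px 0)
      gcongr
      linarith
  have h5 : Γ⁻¹ * (|px 0| + 1) * (b - 0) ≤ Γ⁻¹ * ((|px 0| + 1) * T) := by
    rw [sub_zero, mul_assoc]; gcongr; exact hbT.2
  have h6 : Γ⁻¹ * ((|px 0| + 1) * T) < |x 0| / 2 := by
    rw [inv_mul_lt_iff₀ hΓ]; exact h2
  linarith

/-- By conservation of energy, the short side stays short. -/
theorem abs_y_le (h : CoordSol Γ T Y x y px py) (hΓ : 0 < Γ) (hx0 : x 0 ≠ 0) (hy0 : y 0 ≠ 0)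
    (hxy : |y 0| ≤ |x 0|) (hx : ∀ t ∈ Set.Icc 0 T, |x t - x 0| < |x 0| / 2)
    {t : ℝ} (ht : t ∈ Set.Icc 0 T) (hY : t ∉ Y) :
    |y t| ≤ 8 * Real.exp ((px 0 ^ 2 + py 0 ^ 2) / (2 * Γ)) * |y 0| := by
  obtain ⟨E, hE⟩ := h.energy
  have e1 := hE 0 ⟨le_rfl, ht.1.trans ht.2⟩ h.zero_notMem
  have e2 := hE t ht hY
  have hX : 0 < |x 0| := abs_pos.2 hx0
  have hyp : 0 < |y t| := abs_pos.2 (h.free_y t ht hY)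
  have hy0p : 0 < |y 0| := abs_pos.2 hy0
  have hxl : |x 0| / 2 < |x t| := by
    have := abs_sub_abs_le_abs_sub (x 0) (x t)
    rw [abs_sub_comm (x 0)] at this
    linarith [hx t ht]
  have l1 : Real.log (x 0) - Real.log 2 ≤ Real.log (x t) := by
    rw [← Real.log_abs (x 0), ← Real.log_abs (x t), ← Real.log_div hX.ne' (by norm_num)]
    exact Real.log_le_log (by positivity) hxl.le
  -- Here `x₀² + y₀² ≤ 2 x₀² ≤ 8 x²`, so `16` is generous. With the `log 2` lost in `l1`, the total
  -- loss is `3 log 2`, the factor `8` in the bound.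
  have l2 : Real.log (x 0 ^ 2 + y 0 ^ 2) - Real.log (2 ^ 4)
      ≤ Real.log (x t ^ 2 + y t ^ 2) := by
    rw [← Real.log_div (by positivity) (by norm_num)]
    apply Real.log_le_log (by positivity)
    rw [← sq_abs (x 0), ← sq_abs (y 0), ← sq_abs (x t), ← sq_abs (y t)]
    nlinarith
  rw [Real.log_pow] at l2
  push_cast at l2
  have hk : 0 ≤ (px t ^ 2 + py t ^ 2) / (2 * Γ) := by positivity
  rw [← Real.log_le_log_iff hyp (by positivity), Real.log_mul (by positivity) hy0p.ne',
    Real.log_mul (by norm_num) (by positivity), Real.log_exp, Real.log_abs, Real.log_abs,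
    show (8 : ℝ) = 2 ^ 3 by norm_num, Real.log_pow]
  push_cast
  linarith

/-- The time between two collisions is small if the short side is. -/
theorem gap_le (h : CoordSol Γ T Y x y px py) (hΓ : 0 < Γ) {B : ℝ} (hB : 0 < B)
    (hy : ∀ t ∈ Set.Icc 0 T, t ∉ Y → |y t| ≤ B) {c d : ℝ} (hc : 0 ≤ c) (hcd : c ≤ d) (hd : d ≤ T)
    (hY : ∀ t ∈ Set.Ioo c d, t ∉ Y) : d - c ≤ 3 * √Γ * B := by
  rcases hcd.eq_or_lt with rfl | hlt
  · rw [sub_self]; positivity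
  have hsub : Set.Ioo c d ⊆ Set.Icc 0 T := fun t ht => ⟨hc.trans ht.1.le, ht.2.le.trans hd⟩
  have hsub' : Set.Icc c d ⊆ Set.Icc 0 T := Set.Icc_subset_Icc hc hd
  have hnhds : ∀ t ∈ Set.Ioo c d, Set.Icc 0 T ∈ 𝓝 t := fun t ht =>
    Icc_mem_nhds (hc.trans_lt ht.1) (ht.2.trans_le hd)
  -- By the intermediate value theorem `y` keeps one sign between collisions; `s` is that sign.
  have hsign : ∃ s : ℝ, s ^ 2 = 1 ∧ ∀ t ∈ Set.Ioo c d, 0 < s * y t := by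
    have hne : ∀ t ∈ Set.Ioo c d, y t ≠ 0 := fun t ht => h.free_y t (hsub ht) (hY t ht)
    by_cases hp : ∀ t ∈ Set.Ioo c d, 0 < y t
    · exact ⟨1, by norm_num, by simpa using hp⟩
    · push Not at hp
      obtain ⟨t₀, ht₀, hneg⟩ := hp
      refine ⟨-1, by norm_num, fun t ht => ?_⟩
      by_contra! hcon
      obtain ⟨τ, hτ, h0⟩ := isPreconnected_Ioo.intermediate_value ht₀ ht
        (h.cont_y.mono hsub) (show (0 : ℝ) ∈ Set.Icc (y t₀) (y t) from ⟨hneg, by linarith⟩)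
      exact hne τ hτ h0
  obtain ⟨s, hs, hpos⟩ := hsign
  have hle : ∀ t ∈ Set.Ioo c d, s * y t ≤ B := fun t ht => by
    have h1 : |s| = 1 := by
      rw [← Real.sqrt_sq_eq_abs, hs, Real.sqrt_one]
    calc s * y t ≤ |s * y t| := le_abs_self _
      _ = |y t| := by rw [abs_mul, h1, one_mul]
      _ ≤ B := hy t (hsub ht) (hY t ht)
  -- Both force terms push `y` towards the axis. The term `1 / y` alone gives concavity `1 / (Γ B)`;
  -- the other one only helps.
  have key := mul_sq_length_le (f := fun t => s * y t) (v := fun t => s * (Γ⁻¹ * py t))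
    (w := fun t => s * (Γ⁻¹ * -(1 / y t + y t / (x t ^ 2 + y t ^ 2)))) (m := Γ⁻¹ * (1 / B)) hlt
    (continuousOn_const.mul (h.cont_y.mono hsub')) hpos hle
    (fun t ht => ((h.deriv_y t (hsub ht) (hY t ht)).hasDerivAt (hnhds t ht)).const_mul s)
    (fun t ht => (((h.deriv_py t (hsub ht) (hY t ht)).hasDerivAt (hnhds t ht)).const_mul
      Γ⁻¹).const_mul s) (fun t ht => by
      have hp := hpos t ht
      have hinv : s * (1 / y t) = 1 / (s * y t) := by
        have : y t ≠ 0 := h.free_y t (hsub ht) (hY t ht)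
        have : s ≠ 0 := by rintro rfl; norm_num at hs
        field_simp
        exact hs
      have h1 : 1 / B ≤ 1 / (s * y t) := one_div_le_one_div_of_le hp (hle t ht)
      have h2 : 0 ≤ s * y t / (x t ^ 2 + y t ^ 2) := by positivity
      calc s * (Γ⁻¹ * -(1 / y t + y t / (x t ^ 2 + y t ^ 2)))
          = -(Γ⁻¹ * (s * (1 / y t) + s * y t / (x t ^ 2 + y t ^ 2))) := by ring
        _ ≤ -(Γ⁻¹ * (1 / B)) := by
          rw [hinv]
          gcongr
          linarith)
  -- The estimate gives `(d - c)² ≤ 8 Γ B²`; rounding `8` up to `9` produces the constant `3`.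
  have h1 : (d - c) ^ 2 ≤ (3 * √Γ * B) ^ 2 := by
    rw [mul_pow, mul_pow, Real.sq_sqrt hΓ.le]
    have h2 : Γ⁻¹ * (1 / B) * (d - c) ^ 2 = (d - c) ^ 2 / (Γ * B) := by
      field_simp
    rw [h2, div_le_iff₀ (by positivity)] at key
    nlinarith [mul_pos hΓ (pow_pos hB 2)]
  exact le_of_sq_le_sq h1 (by positivity)

/-- On a short time interval, only the close pairs collide, and they do so often. -/
theorem length_le_and_collisions (h : CoordSol Γ T Y x y px py) (hΓ : 0 < Γ) (hT : 0 ≤ T)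
    (hx0 : x 0 ≠ 0) (hy0 : y 0 ≠ 0) (hxy : |y 0| ≤ |x 0|)
    (h1 : 4 * T ≤ |x 0|) (h2 : (|px 0| + 1) * T < Γ * (|x 0| / 2)) :
    T ≤ (Y.card + 1) *
      (3 * √Γ * (8 * Real.exp ((px 0 ^ 2 + py 0 ^ 2) / (2 * Γ)) * |y 0|)) ∧
    ∀ σ ∈ Y, y σ = 0 ∧ x σ ≠ 0 := by
  have hx := h.abs_x_sub_lt hΓ hx0 h1 h2
  have hy0p : 0 < |y 0| := abs_pos.2 hy0
  constructor
  · have := length_le_of_gaps_le Y hT fun c d hc hcd hd hY =>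
      h.gap_le hΓ (by positivity) (fun t ht hY => h.abs_y_le hΓ hx0 hy0 hxy hx ht hY) hc hcd hd hY
    rwa [sub_zero] at this
  · intro σ hσ
    rcases h.collision σ hσ with ⟨h0, h1, -⟩ | ⟨h0, -⟩
    · exact ⟨h0, h1⟩
    · have := hx σ (Set.Ioo_subset_Icc_self (h.times σ hσ))
      rw [h0, zero_sub, abs_neg] at this
      linarith [abs_nonneg (x 0)]

end CoordSol

end DihedralVortex

/-! ### The angle of the one-dimensional logarithmic oscillator. -/

noncomputable section

namespace DihedralVortex

/-- The continuous extension of `v ↦ (v - 1) / log v` to `[0, 1]`. -/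
def invLogChord (v : ℝ) : ℝ := (dslope Real.log 1 v)⁻¹

theorem invLogChord_of_ne {v : ℝ} (h : v ≠ 1) : invLogChord v = (v - 1) * (Real.log v)⁻¹ := by
  rw [invLogChord, dslope_of_ne _ h, slope_def_field, Real.log_one, sub_zero, inv_div,
    div_eq_mul_inv]

/-- The conventions `log 0 = 0` and `0⁻¹ = 0` yield exactly the limit value at `0`. -/
theorem invLogChord_zero : invLogChord 0 = 0 := by
  rw [invLogChord_of_ne (by norm_num)]; simp

theorem invLogChord_one : invLogChord 1 = 1 := by
  rw [invLogChord, dslope_same, Real.deriv_log]; simp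

theorem invLogChord_mul_log {v : ℝ} (h : 0 < v) : invLogChord v * Real.log v = v - 1 := by
  rcases eq_or_ne v 1 with rfl | h1
  · simp
  · rw [invLogChord_of_ne h1, mul_assoc, inv_mul_cancel₀ (Real.log_ne_zero_of_pos_of_ne_one h h1),
      mul_one]

theorem le_invLogChord {v : ℝ} (h0 : 0 ≤ v) (h1 : v ≤ 1) : v ≤ invLogChord v := by
  rcases h0.eq_or_lt with rfl | h0
  · exact invLogChord_zero.ge
  rcases h1.eq_or_lt with rfl | h1
  · exact invLogChord_one.ge
  have hl : Real.log v < 0 := Real.log_neg h0 h1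
  have h2 := Real.log_le_sub_one_of_pos (inv_pos.2 h0)
  rw [Real.log_inv] at h2
  have h3 := mul_le_mul_of_nonneg_left h2 h0.le
  rw [mul_sub, mul_inv_cancel₀ h0.ne'] at h3
  have h4 := invLogChord_mul_log h0
  by_contra! hc
  nlinarith

theorem invLogChord_le_one {v : ℝ} (h0 : 0 ≤ v) (h1 : v ≤ 1) : invLogChord v ≤ 1 := by
  rcases h0.eq_or_lt with rfl | h0
  · rw [invLogChord_zero]; exact zero_le_one
  rcases h1.eq_or_lt with rfl | h1
  · exact invLogChord_one.le
  have hl : Real.log v < 0 := Real.log_neg h0 h1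
  have h2 := Real.log_le_sub_one_of_pos h0
  have h4 := invLogChord_mul_log h0
  by_contra! hc
  nlinarith

theorem continuousAt_invLogChord {v : ℝ} (h0 : 0 ≤ v) (h1 : v ≤ 1) :
    ContinuousAt invLogChord v := by
  rcases h0.eq_or_lt with rfl | h0
  · rw [← continuousWithinAt_compl_self, ContinuousWithinAt, invLogChord_zero]
    have h2 : Tendsto (fun v : ℝ => (v - 1) * (Real.log v)⁻¹) (𝓝[≠] 0) (𝓝 ((0 - 1) * 0)) :=
      (((continuous_id.sub continuous_const).tendsto (0 : ℝ)).mono_left nhdsWithin_le_nhds).mul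
        Real.tendsto_log_nhdsNE_zero.inv_tendsto_atBot
    rw [mul_zero] at h2
    refine h2.congr' ?_
    filter_upwards [mem_nhdsWithin_of_mem_nhds (isOpen_ne.mem_nhds (zero_ne_one' ℝ))] with w hw
    exact (invLogChord_of_ne hw).symm
  rcases eq_or_ne v 1 with rfl | h1'
  · refine ContinuousAt.inv₀ (continuousAt_dslope_same.2
      (Real.differentiableAt_log one_ne_zero)) ?_
    rw [dslope_same, Real.deriv_log]; simp
  · refine ContinuousAt.inv₀ ((continuousAt_dslope_of_ne h1').2 (Real.continuousAt_log h0.ne')) ?_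
    rw [dslope_of_ne _ h1', slope_def_field, Real.log_one, sub_zero]
    exact div_ne_zero (Real.log_ne_zero_of_pos_of_ne_one h0 h1') (sub_ne_zero.2 h1')

/-- The rate of time with respect to the angle of the regularized one-dimensional oscillator;
it vanishes at the collisions `sin φ = 0`. -/
def timeRate (φ : ℝ) : ℝ := √(invLogChord (Real.sin φ ^ 2))

theorem continuous_timeRate : Continuous timeRate :=
  Real.continuous_sqrt.comp <| continuous_iff_continuousAt.2 fun φ =>
    (continuousAt_invLogChord (sq_nonneg _) (Real.sin_sq_le_one φ)).comp
      (f := fun φ => Real.sin φ ^ 2) (by fun_prop)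

theorem timeRate_nonneg (φ : ℝ) : 0 ≤ timeRate φ := Real.sqrt_nonneg _

theorem timeRate_le_one (φ : ℝ) : timeRate φ ≤ 1 :=
  Real.sqrt_le_one.2 (invLogChord_le_one (sq_nonneg _) (Real.sin_sq_le_one φ))

theorem sin_sq_le_timeRate (φ : ℝ) : Real.sin φ ^ 2 ≤ timeRate φ := by
  refine Real.le_sqrt_of_sq_le ?_
  have h := le_invLogChord (sq_nonneg _) (Real.sin_sq_le_one φ)
  have := sq_nonneg (Real.sin φ)
  nlinarith [Real.sin_sq_le_one φ]

theorem timeRate_pos {φ : ℝ} (h : Real.sin φ ≠ 0) : 0 < timeRate φ :=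
  (by positivity : 0 < Real.sin φ ^ 2).trans_le (sin_sq_le_timeRate φ)

theorem timeRate_sq (φ : ℝ) : timeRate φ ^ 2 = invLogChord (Real.sin φ ^ 2) :=
  Real.sq_sqrt ((sq_nonneg _).trans (le_invLogChord (sq_nonneg _) (Real.sin_sq_le_one φ)))

/-- The momentum of the oscillator at the angle `φ`. -/
def angleMomentum (φ : ℝ) : ℝ := Real.cos φ / timeRate φ

/-- This is the energy relation of the oscillator: half the squared momentum plus `log |sin φ|` is
zero. It is what dictates the choice of `timeRate`. -/
theorem angleMomentum_sq {φ : ℝ} (h : Real.sin φ ≠ 0) :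
    angleMomentum φ ^ 2 = -Real.log (Real.sin φ ^ 2) := by
  have h1 := timeRate_pos h
  have h2 := invLogChord_mul_log (v := Real.sin φ ^ 2) (by positivity)
  rw [← timeRate_sq] at h2
  rw [angleMomentum, div_pow, div_eq_iff (by positivity)]
  linarith [Real.sin_sq_add_cos_sq φ]

theorem hasDerivAt_angleMomentum {φ : ℝ} (h : Real.sin φ ≠ 0) :
    HasDerivAt angleMomentum (-(timeRate φ / Real.sin φ)) φ := by
  have hpos := timeRate_pos h
  -- At a turning point the square root formula for the momentum is not differentiable. There `cos`
  -- vanishes, so the slope of the quotient is the slope of `cos` times `1 / timeRate`, and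
  -- continuity of `timeRate` suffices.
  rcases eq_or_ne (Real.cos φ) 0 with hc | hc
  · have hs : Real.sin φ ^ 2 = 1 := by have := Real.sin_sq_add_cos_sq φ; simpa [hc] using this
    have h1 : timeRate φ = 1 := by rw [timeRate, hs, invLogChord_one, Real.sqrt_one]
    have h2 := hasDerivAt_iff_tendsto_slope.1 (Real.hasDerivAt_cos φ)
    have h3 : Tendsto (fun t => (timeRate t)⁻¹) (𝓝[≠] φ) (𝓝 1⁻¹) := by
      have := (continuous_timeRate.tendsto φ).mono_left (nhdsWithin_le_nhds (s := {φ}ᶜ))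
      rw [h1] at this
      exact this.inv₀ one_ne_zero
    rw [hasDerivAt_iff_tendsto_slope]
    have h4 : -(timeRate φ / Real.sin φ) = -Real.sin φ * 1⁻¹ := by
      rw [h1]; field_simp; rw [hs]
    rw [h4]
    refine (h2.mul h3).congr fun t => ?_
    simp only [slope_def_field, angleMomentum, hc]
    ring
  · obtain ⟨s, hs, hsc⟩ : ∃ s : ℝ, s ^ 2 = 1 ∧ 0 < s * Real.cos φ := by
      rcases hc.lt_or_gt with hc | hc
      · exact ⟨-1, by norm_num, by linarith⟩
      · exact ⟨1, by norm_num, by linarith⟩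
    have hs0 : s ≠ 0 := by rintro rfl; norm_num at hs
    have hev : angleMomentum =ᶠ[𝓝 φ] fun t => s * √(-Real.log (Real.sin t ^ 2)) := by
      have e1 : ∀ᶠ t in 𝓝 φ, 0 < s * Real.cos t :=
        (continuous_const.mul Real.continuous_cos).continuousAt.eventually_const_lt hsc
      have e2 : ∀ᶠ t in 𝓝 φ, Real.sin t ≠ 0 := Real.continuous_sin.continuousAt.eventually_ne h
      filter_upwards [e1, e2] with t h1 h2
      have h3 : 0 ≤ s * angleMomentum t := by
        rw [angleMomentum, ← mul_div_assoc]
        exact div_nonneg h1.le (timeRate_nonneg t)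
      rw [← angleMomentum_sq h2, show angleMomentum t ^ 2 = (s * angleMomentum t) ^ 2 by
        rw [mul_pow, hs, one_mul], Real.sqrt_sq h3, ← mul_assoc, ← sq, hs, one_mul]
    have hval := hev.self_of_nhds
    have hw : angleMomentum φ ≠ 0 := div_ne_zero hc hpos.ne'
    have hsq := angleMomentum_sq h
    have hne : -Real.log (Real.sin φ ^ 2) ≠ 0 := by rw [← hsq]; positivity
    have hsin : HasDerivAt (fun t => Real.sin t ^ 2) (2 * Real.sin φ * Real.cos φ) φ :=
      ((Real.hasDerivAt_sin φ).pow 2).congr_deriv (by simp)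
    have hd := ((hsin.log (pow_ne_zero 2 h)).neg.sqrt hne).const_mul s
    refine (hd.congr_of_eventuallyEq hev).congr_deriv ?_
    have h5 : √(-Real.log (Real.sin φ ^ 2)) = s * angleMomentum φ := by
      simp only at hval
      rw [hval, ← mul_assoc, ← sq, hs, one_mul]
    rw [Pi.neg_apply, h5]
    rw [angleMomentum]
    field_simp

/-- The **Picard-Lindelöf theorem** with control of the range of the solution. -/
theorem exists_solution_mem_closedBall {E : Type*} [NormedAddCommGroup E] [NormedSpace ℝ E]
    [CompleteSpace E] {f : ℝ → E → E} {tmin tmax : ℝ} {t₀ : Set.Icc tmin tmax} {x₀ : E}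
    {a L K : NNReal} (hf : IsPicardLindelof f t₀ x₀ a 0 L K) :
    ∃ α : ℝ → E, α t₀ = x₀ ∧ ∀ t ∈ Set.Icc tmin tmax,
      HasDerivWithinAt α (f t (α t)) (Set.Icc tmin tmax) t ∧ α t ∈ Metric.closedBall x₀ a := by
  have hx : x₀ ∈ Metric.closedBall x₀ ((0 : NNReal) : ℝ) := Metric.mem_closedBall_self le_rfl
  obtain ⟨α, hα⟩ := ODE.FunSpace.exists_isFixedPt_next hf hx
  refine ⟨α.compProj, ?_, fun t ht => ⟨?_, α.compProj_mem_closedBall hf.mul_max_le⟩⟩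
  · rw [ODE.FunSpace.compProj_val, ← hα, ODE.FunSpace.next_apply₀]
  · refine (ODE.hasDerivWithinAt_picard_Icc t₀.2 hf.continuousOn_uncurry
      α.continuous_compProj.continuousOn
      (fun _ _ => α.compProj_mem_closedBall hf.mul_max_le) x₀ ht).congr_of_mem ?_ ht
    intro t' ht'
    nth_rw 1 [← hα]
    rw [ODE.FunSpace.compProj_of_mem ht', ODE.FunSpace.next_apply]

end DihedralVortex

end

/-! ### The regularized equations and their solution over many half-turns. -/

noncomputable section

namespace DihedralVortex

/-- The vector field of the regularized equations, divided by `η`, in the variables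
`(ξ, π, e, u)`, with `(η, timeRate φ, sin φ, cos φ)` as parameters. -/
def regField (γ : ℝ) (z : (ℝ × ℝ × ℝ × ℝ) × (ℝ × ℝ × ℝ × ℝ)) : ℝ × ℝ × ℝ × ℝ :=
  let η := z.1.1
  let g := z.1.2.1
  let s := z.1.2.2.1
  let c := z.1.2.2.2
  let ξ := z.2.1
  let e := z.2.2.2.1
  let y := η * Real.exp e * s
  let τ := γ * Real.exp e * g * ((ξ ^ 2 + y ^ 2) / (ξ ^ 2 + 2 * y ^ 2))
  (z.2.2.1 / γ ^ 2 * τ, -(1 / ξ + ξ / (ξ ^ 2 + y ^ 2)) * τ,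
    -(η * Real.exp e ^ 2 * s * c / (ξ ^ 2 + 2 * y ^ 2)), τ)

/-- Treating `timeRate φ`, `sin φ`, `cos φ` as parameters gives smoothness without differentiating
`timeRate`, for which only continuity is available at collisions. Lipschitz constants and bounds on
compact sets are then uniform in `η` and `φ`. -/
theorem contDiffOn_regField (γ : ℝ) : ContDiffOn ℝ 1 (regField γ) {z | 0 < z.2.1} := by
  have h0 : ∀ z ∈ {z : (ℝ × ℝ × ℝ × ℝ) × (ℝ × ℝ × ℝ × ℝ) | 0 < z.2.1}, z.2.1 ≠ 0 :=
    fun z hz => ne_of_gt hz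
  have h1 : ∀ z ∈ {z : (ℝ × ℝ × ℝ × ℝ) × (ℝ × ℝ × ℝ × ℝ) | 0 < z.2.1},
      z.2.1 ^ 2 + (z.1.1 * Real.exp z.2.2.2.1 * z.1.2.2.1) ^ 2 ≠ 0 := fun z hz => by
    have : 0 < z.2.1 := hz
    positivity
  have h2 : ∀ z ∈ {z : (ℝ × ℝ × ℝ × ℝ) × (ℝ × ℝ × ℝ × ℝ) | 0 < z.2.1},
      z.2.1 ^ 2 + 2 * (z.1.1 * Real.exp z.2.2.2.1 * z.1.2.2.1) ^ 2 ≠ 0 := fun z hz => by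
    have : 0 < z.2.1 := hz
    positivity
  have hτ : ContDiffOn ℝ 1 (fun z : (ℝ × ℝ × ℝ × ℝ) × (ℝ × ℝ × ℝ × ℝ) =>
      γ * Real.exp z.2.2.2.1 * z.1.2.1 *
      ((z.2.1 ^ 2 + (z.1.1 * Real.exp z.2.2.2.1 * z.1.2.2.1) ^ 2) /
      (z.2.1 ^ 2 + 2 * (z.1.1 * Real.exp z.2.2.2.1 * z.1.2.2.1) ^ 2))) {z | 0 < z.2.1} := by
    refine ContDiffOn.mul (by fun_prop) (ContDiffOn.div (by fun_prop) (by fun_prop) h2)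
  refine ContDiffOn.prodMk (ContDiffOn.mul (by fun_prop) hτ) (ContDiffOn.prodMk
    (ContDiffOn.mul (ContDiffOn.neg (ContDiffOn.add (ContDiffOn.div (by fun_prop) (by fun_prop) h0)
      (ContDiffOn.div (by fun_prop) (by fun_prop) h1))) hτ)
    (ContDiffOn.prodMk (ContDiffOn.neg (ContDiffOn.div (by fun_prop) (by fun_prop) h2)) hτ))

/-- The transverse coordinate at the angle `φ`, in units of the longitudinal one. -/
def transverse (η : ℝ) (e : ℝ → ℝ) (φ : ℝ) : ℝ := η * Real.exp (e φ) * Real.sin φ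

/-- The derivative of time with respect to the angle. -/
def timeSpeed (γ η : ℝ) (ξ e : ℝ → ℝ) (φ : ℝ) : ℝ :=
  η * (γ * Real.exp (e φ) * timeRate φ *
    ((ξ φ ^ 2 + transverse η e φ ^ 2) / (ξ φ ^ 2 + 2 * transverse η e φ ^ 2)))

/-- Solutions of the regularized equations, with the angle as independent variable:
`ξ`, `π` are longitudinal position and momentum, `e` is the logarithm of the
amplitude of the transverse oscillation and `u` is time. -/
structure AngularSol (γ η : ℝ) (I : Set ℝ) (ξ π e u : ℝ → ℝ) : Prop where
  pos : ∀ φ ∈ I, 0 < ξ φ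
  deriv_ξ : ∀ φ ∈ I, HasDerivAt ξ (π φ / γ ^ 2 * timeSpeed γ η ξ e φ) φ
  deriv_π : ∀ φ ∈ I, HasDerivAt π
    (-(1 / ξ φ + ξ φ / (ξ φ ^ 2 + transverse η e φ ^ 2)) * timeSpeed γ η ξ e φ) φ
  deriv_e : ∀ φ ∈ I, HasDerivAt e (-((η * Real.exp (e φ)) ^ 2 * Real.sin φ * Real.cos φ /
    (ξ φ ^ 2 + 2 * transverse η e φ ^ 2))) φ
  deriv_u : ∀ φ ∈ I, HasDerivAt u (timeSpeed γ η ξ e φ) φ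

theorem hasDerivWithinAt_prod_iff {E F : Type*} [NormedAddCommGroup E] [NormedSpace ℝ E]
    [NormedAddCommGroup F] [NormedSpace ℝ F] {f : ℝ → E × F} {v : E × F} {s : Set ℝ} {t : ℝ} :
    HasDerivWithinAt f v s t ↔ HasDerivWithinAt (fun t => (f t).1) v.1 s t ∧
      HasDerivWithinAt (fun t => (f t).2) v.2 s t :=
  ⟨fun h => ⟨(ContinuousLinearMap.fst ℝ E F).hasFDerivAt.comp_hasDerivWithinAt t h,
    (ContinuousLinearMap.snd ℝ E F).hasFDerivAt.comp_hasDerivWithinAt t h⟩,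
    fun h => h.1.prodMk h.2⟩

/-- For small `η` the regularized equations can be solved over long intervals of angles. -/
theorem exists_angularSol (γ P Q : ℝ) :
    ∃ C : ℝ, 0 < C ∧ ∀ η ℓ : ℝ, 0 < η → η ≤ 1 → 1 ≤ ℓ → C * η * ℓ ≤ 1 / 2 →
      ∀ φ₀ π₀ e₀ : ℝ, |π₀| ≤ P → 0 ≤ e₀ → e₀ ≤ Q → ∃ ξ π e u : ℝ → ℝ,
        AngularSol γ η (Set.Ioo (φ₀ - 1) (φ₀ + ℓ)) ξ π e u ∧ ξ φ₀ = 1 ∧ π φ₀ = π₀ ∧ e φ₀ = e₀ ∧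
          u φ₀ = 0 ∧ ∀ φ ∈ Set.Ioo (φ₀ - 1) (φ₀ + ℓ), -(1 / 2) ≤ e φ ∧
            |timeSpeed γ η ξ e φ| ≤ C * η := by
  -- A compact convex box containing all parameter values with `η ≤ 1` and every ball of radius `1 /
  -- 2` about an admissible initial state.
  let S : Set ((ℝ × ℝ × ℝ × ℝ) × (ℝ × ℝ × ℝ × ℝ)) :=
    (Set.Icc 0 1 ×ˢ Set.Icc 0 1 ×ˢ Set.Icc (-1) 1 ×ˢ Set.Icc (-1) 1) ×ˢ
    (Set.Icc (1 / 2) 2 ×ˢ Set.Icc (-P - 1) (P + 1) ×ˢ Set.Icc (-1) (Q + 1) ×ˢ Set.Icc (-1) 1)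
  have hS : IsCompact S :=
    (isCompact_Icc.prod (isCompact_Icc.prod (isCompact_Icc.prod isCompact_Icc))).prod
      (isCompact_Icc.prod (isCompact_Icc.prod (isCompact_Icc.prod isCompact_Icc)))
  have hSc : Convex ℝ S :=
    ((convex_Icc _ _).prod ((convex_Icc _ _).prod ((convex_Icc _ _).prod (convex_Icc _ _)))).prod
      ((convex_Icc _ _).prod ((convex_Icc _ _).prod ((convex_Icc _ _).prod (convex_Icc _ _))))
  have hreg : ContDiffOn ℝ 1 (regField γ) S := (contDiffOn_regField γ).mono fun z hz =>
    (by norm_num : (0 : ℝ) < 1 / 2).trans_le hz.2.1.1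
  obtain ⟨K, hK⟩ := hreg.exists_lipschitzOnWith one_ne_zero hSc hS
  obtain ⟨C, hC⟩ := hS.exists_bound_of_continuousOn hreg.continuousOn
  refine ⟨max C 1, by positivity, fun η ℓ hη hη1 hℓ hsmall φ₀ π₀ e₀ hπ₀ he₀ heQ => ?_⟩
  have hball : ∀ φ, ∀ v ∈ Metric.closedBall ((1, π₀, e₀, 0) : ℝ × ℝ × ℝ × ℝ) ((1 / 2 : NNReal) : ℝ),
      (((η, timeRate φ, Real.sin φ, Real.cos φ), v) : (ℝ × ℝ × ℝ × ℝ) × (ℝ × ℝ × ℝ × ℝ)) ∈ S := by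
    intro φ v hv
    simp only [Metric.mem_closedBall, Prod.dist_eq, Real.dist_eq, sup_le_iff] at hv
    push_cast at hv
    obtain ⟨h1, h2, h3, h4⟩ := hv
    rw [abs_le] at h1 h2 h3 h4 hπ₀
    refine ⟨⟨⟨hη.le, hη1⟩, ⟨timeRate_nonneg φ, timeRate_le_one φ⟩, ⟨Real.neg_one_le_sin φ,
      Real.sin_le_one φ⟩, ⟨Real.neg_one_le_cos φ, Real.cos_le_one φ⟩⟩, ⟨?_, ?_⟩, ⟨?_, ?_⟩,
      ⟨?_, ?_⟩, ⟨?_, ?_⟩⟩ <;> simp only <;> linarith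
  let f : ℝ → (ℝ × ℝ × ℝ × ℝ) → (ℝ × ℝ × ℝ × ℝ) := fun φ v =>
    η • regField γ ((η, timeRate φ, Real.sin φ, Real.cos φ), v)
  have hf : ∀ φ, ∀ v ∈ Metric.closedBall ((1, π₀, e₀, 0) : ℝ × ℝ × ℝ × ℝ) ((1 / 2 : NNReal) : ℝ),
      ‖f φ v‖ ≤ max C 1 * η := fun φ v hv => by
    rw [norm_smul, Real.norm_of_nonneg hη.le, mul_comm]
    gcongr
    exact (hC _ (hball φ v hv)).trans (le_max_left _ _)
  have hmem : φ₀ ∈ Set.Icc (φ₀ - 1) (φ₀ + ℓ) := ⟨by linarith, by linarith⟩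
  -- The factor `η` bounds the speed by `max C 1 * η`, so over angular length `ℓ` the solution moves
  -- by at most `1 / 2` and stays in the ball.
  have hPL : IsPicardLindelof f ⟨φ₀, hmem⟩ ((1, π₀, e₀, 0) : ℝ × ℝ × ℝ × ℝ) (1 / 2) 0
      (Real.toNNReal (max C 1 * η)) (Real.toNNReal η * K) := by
    refine ⟨fun φ _ => ?_, fun v hv => ?_, fun φ _ v hv => ?_, ?_⟩
    · refine LipschitzOnWith.of_dist_le_mul fun v hv w hw => ?_
      rw [dist_smul₀, Real.norm_of_nonneg hη.le]
      push_cast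
      rw [Real.coe_toNNReal _ hη.le, mul_assoc]
      gcongr
      refine (hK.dist_le_mul _ (hball φ v hv) _ (hball φ w hw)).trans (le_of_eq ?_)
      simp [Prod.dist_eq]
    · refine ContinuousOn.const_smul ?_ η
      refine hreg.continuousOn.comp (Continuous.continuousOn ?_) fun φ _ => hball φ v hv
      have := continuous_timeRate
      fun_prop
    · rw [Real.coe_toNNReal _ (by positivity)]
      exact hf φ v hv
    · rw [Real.coe_toNNReal _ (by positivity)]
      simp only [add_sub_cancel_left, sub_sub_cancel, max_eq_left hℓ]
      push_cast
      linarith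
  obtain ⟨α, hα0, hα⟩ := exists_solution_mem_closedBall hPL
  replace hα0 : α φ₀ = (1, π₀, e₀, 0) := hα0
  have hder : ∀ φ ∈ Set.Ioo (φ₀ - 1) (φ₀ + ℓ), ∀ {g : ℝ → ℝ} {v : ℝ},
      HasDerivWithinAt g v (Set.Icc (φ₀ - 1) (φ₀ + ℓ)) φ → HasDerivAt g v φ :=
    fun φ hφ g v h => h.hasDerivAt (Icc_mem_nhds hφ.1 hφ.2)
  have hcoord := fun φ (hφ : φ ∈ Set.Ioo (φ₀ - 1) (φ₀ + ℓ)) =>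
    (hα φ (Set.Ioo_subset_Icc_self hφ)).1
  simp only [hasDerivWithinAt_prod_iff] at hcoord
  have hS' := fun φ (hφ : φ ∈ Set.Ioo (φ₀ - 1) (φ₀ + ℓ)) =>
    hball φ _ (hα φ (Set.Ioo_subset_Icc_self hφ)).2
  refine ⟨fun φ => (α φ).1, fun φ => (α φ).2.1, fun φ => (α φ).2.2.1, fun φ => (α φ).2.2.2,
    ⟨fun φ hφ => (by norm_num : (0 : ℝ) < 1 / 2).trans_le (hS' φ hφ).2.1.1,
      fun φ hφ => (hder φ hφ (hcoord φ hφ).1).congr_deriv ?_,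
      fun φ hφ => (hder φ hφ (hcoord φ hφ).2.1).congr_deriv ?_,
      fun φ hφ => (hder φ hφ (hcoord φ hφ).2.2.1).congr_deriv ?_,
      fun φ hφ => (hder φ hφ (hcoord φ hφ).2.2.2).congr_deriv ?_⟩, ?_, ?_, ?_, ?_, fun φ hφ => ?_⟩
  · simp only [f, regField, timeSpeed, transverse, Prod.smul_fst, smul_eq_mul]; ring
  · simp only [f, regField, timeSpeed, transverse, Prod.smul_fst, Prod.smul_snd, smul_eq_mul]; ring
  · simp only [f, regField, transverse, Prod.smul_fst, Prod.smul_snd, smul_eq_mul]; ring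
  · simp only [f, regField, timeSpeed, transverse, Prod.smul_snd, smul_eq_mul]
  · simp only [hα0]
  · simp only [hα0]
  · simp only [hα0]
  · simp only [hα0]
  · have hb := (hα φ (Set.Ioo_subset_Icc_self hφ)).2
    constructor
    · have hb' := hb
      simp only [Metric.mem_closedBall, Prod.dist_eq, Real.dist_eq, sup_le_iff] at hb'
      push_cast at hb'
      have := (abs_le.1 hb'.2.2.1).1
      simp only
      linarith
    · refine le_trans ?_ (hf φ _ hb)
      refine le_trans (le_of_eq ?_) ((norm_snd_le _).trans' ((norm_snd_le _).trans'
        (norm_snd_le _)))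
      rw [Real.norm_eq_abs]
      simp only [f, regField, timeSpeed, transverse, Prod.smul_snd, smul_eq_mul]

end DihedralVortex

end

/-! ### From angular solutions back to generalized solutions in time. -/

noncomputable section

namespace DihedralVortex

/-- The derivative of time vanishes at collisions, so the inverse is obtained from strict
monotonicity and not from the inverse function theorem. -/
theorem exists_continuous_inverse {u : ℝ → ℝ} {a b : ℝ} (hu : StrictMonoOn u (Set.Ioo a b))
    (hc : ContinuousOn u (Set.Ioo a b)) :
    ∃ θ : ℝ → ℝ, ∀ φ ∈ Set.Ioo a b, θ (u φ) = φ ∧ ContinuousAt θ (u φ) ∧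
      ∀ᶠ s in 𝓝 (u φ), u (θ s) = s := by
  have hleft : Set.LeftInvOn (Function.invFunOn u (Set.Ioo a b)) u (Set.Ioo a b) :=
    hu.injOn.leftInvOn_invFunOn
  have hnhds : ∀ φ ∈ Set.Ioo a b, u '' Set.Ioo a b ∈ 𝓝 (u φ) := fun φ hφ => by
    obtain ⟨c, hac, hcφ⟩ := exists_between hφ.1
    obtain ⟨d, hφd, hdb⟩ := exists_between hφ.2
    have hsub : Set.Icc c d ⊆ Set.Ioo a b := Set.Icc_subset_Ioo hac hdb
    have h1 : u c < u φ := hu ⟨hac, hcφ.trans hφ.2⟩ hφ hcφ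
    have h2 : u φ < u d := hu hφ ⟨hφ.1.trans hφd, hdb⟩ hφd
    filter_upwards [Icc_mem_nhds h1 h2] with s hs
    exact Set.image_mono hsub (intermediate_value_Icc (hcφ.trans hφd).le (hc.mono hsub) hs)
  have hmono : StrictMonoOn (Function.invFunOn u (Set.Ioo a b)) (u '' Set.Ioo a b) := by
    rintro _ ⟨x, hx, rfl⟩ _ ⟨y, hy, rfl⟩ hxy
    rw [hleft hx, hleft hy]
    exact (hu.lt_iff_lt hx hy).1 hxy
  refine ⟨Function.invFunOn u (Set.Ioo a b), fun φ hφ => ⟨hleft hφ, ?_, ?_⟩⟩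
  · refine hmono.continuousAt_of_image_mem_nhds (hnhds φ hφ) ?_
    rw [hleft hφ, hleft.image_image]
    exact Ioo_mem_nhds hφ.1 hφ.2
  · filter_upwards [hnhds φ hφ] with s hs
    obtain ⟨x, hx, rfl⟩ := hs
    rw [hleft hx]

theorem finite_sin_eq_zero (a b : ℝ) : {φ ∈ Set.Icc a b | Real.sin φ = 0}.Finite := by
  refine ((Set.finite_Icc ⌊a / Real.pi⌋ ⌈b / Real.pi⌉).image fun k : ℤ => k * Real.pi).subset ?_
  rintro φ ⟨⟨h1, h2⟩, h3⟩
  obtain ⟨k, rfl⟩ := Real.sin_eq_zero_iff.1 h3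
  have hp := Real.pi_pos
  refine ⟨k, ⟨?_, ?_⟩, rfl⟩
  · have : a / Real.pi ≤ k := by rwa [div_le_iff₀ hp]
    exact_mod_cast (Int.floor_le _).trans this
  · have : k ≤ b / Real.pi := by rwa [le_div_iff₀ hp]
    exact_mod_cast this.trans (Int.le_ceil _)

/-- The zeros of `sin` are sign changes; this is what makes the continuation a transmission. -/
theorem sin_mul_sin_neg {a b c : ℝ} (h : Real.sin c = 0) (hab : a < c) (hcb : c < b)
    (ha : c - a < Real.pi) (hb : b - c < Real.pi) : Real.sin b * Real.sin a < 0 := by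
  have h1 : Real.sin b = Real.cos c * Real.sin (b - c) := by
    rw [show b = c + (b - c) by ring, Real.sin_add, h]; simp
  have h2 : Real.sin a = -(Real.cos c * Real.sin (c - a)) := by
    rw [show a = c - (c - a) by ring, Real.sin_sub, h]; simp
  have h3 : Real.cos c ^ 2 = 1 := by have := Real.sin_sq_add_cos_sq c; simpa [h] using this
  have h4 := Real.sin_pos_of_pos_of_lt_pi (sub_pos.2 hcb) hb
  have h5 := Real.sin_pos_of_pos_of_lt_pi (sub_pos.2 hab) ha
  have : Real.sin b * Real.sin a = -(Real.cos c ^ 2 * (Real.sin (b - c) * Real.sin (c - a))) := by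
    rw [h1, h2]; ring
  rw [this, h3, one_mul]
  exact neg_neg_of_pos (mul_pos h4 h5)

namespace AngularSol

variable {γ η : ℝ} {I : Set ℝ} {ξ π e u : ℝ → ℝ}

/-- The variation of the amplitude contributes the factor `(ξ² + y²) / (ξ² + 2y²)`, the same one as
in `timeSpeed`; their quotient leaves exactly `py / Γ` as velocity. -/
theorem hasDerivAt_transverse (h : AngularSol γ η I ξ π e u) {φ : ℝ} (hφ : φ ∈ I) :
    HasDerivAt (transverse η e) (η * Real.exp (e φ) * Real.cos φ *
      ((ξ φ ^ 2 + transverse η e φ ^ 2) / (ξ φ ^ 2 + 2 * transverse η e φ ^ 2))) φ := by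
  have := (((h.deriv_e φ hφ).exp.const_mul η).mul (Real.hasDerivAt_sin φ))
  refine this.congr_deriv ?_
  have hpos := h.pos φ hφ
  have h2 : ξ φ ^ 2 + 2 * transverse η e φ ^ 2 ≠ 0 := by positivity
  field_simp
  simp only [transverse]
  ring

/-- In the total energy `e` replaces the transverse kinetic energy plus `log |y|`, which are
separately infinite at collisions. The sum is therefore differentiable through collisions, and its
constant is the same on both sides. -/
theorem exists_energy_eq (hγ : 0 < γ) (hI : IsOpen I) (hI' : IsPreconnected I)
    (h : AngularSol γ η I ξ π e u) : ∃ E, ∀ φ ∈ I, π φ ^ 2 / (2 * γ ^ 2) + Real.log (ξ φ) + e φ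
      + Real.log (ξ φ ^ 2 + transverse η e φ ^ 2) / 2 = E := by
  have hder : ∀ φ ∈ I, HasDerivAt (fun φ => π φ ^ 2 / (2 * γ ^ 2) + Real.log (ξ φ) + e φ
      + Real.log (ξ φ ^ 2 + transverse η e φ ^ 2) / 2) 0 φ := fun φ hφ => by
    have hpos := h.pos φ hφ
    have h1 : ξ φ ^ 2 + transverse η e φ ^ 2 ≠ 0 := by positivity
    have h2 : ξ φ ^ 2 + 2 * transverse η e φ ^ 2 ≠ 0 := by positivity
    have := ((((h.deriv_π φ hφ).pow 2).div_const (2 * γ ^ 2)).add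
      ((h.deriv_ξ φ hφ).log hpos.ne')).add (h.deriv_e φ hφ) |>.add
      ((((h.deriv_ξ φ hφ).pow 2).add ((h.hasDerivAt_transverse hφ).pow 2)).log h1 |>.div_const 2)
    refine this.congr_deriv ?_
    have h3 : (η * Real.exp (e φ)) ^ 2 * Real.sin φ * Real.cos φ =
      transverse η e φ * (η * Real.exp (e φ) * Real.cos φ) := by rw [transverse]; ring
    rw [h3]
    simp only [Pi.add_apply, Pi.pow_apply]
    generalize timeSpeed γ η ξ e φ = τ
    generalize η * Real.exp (e φ) * Real.cos φ = c
    field_simp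
    ring
  exact hI.exists_is_const_of_deriv_eq_zero hI'
    (fun φ hφ => (hder φ hφ).differentiableAt.differentiableWithinAt) fun φ hφ => (hder φ hφ).deriv

theorem timeSpeed_pos (h : AngularSol γ η I ξ π e u) (hγ : 0 < γ) (hη : 0 < η) {φ : ℝ}
    (hφ : φ ∈ I) (hs : Real.sin φ ≠ 0) : 0 < timeSpeed γ η ξ e φ := by
  have := h.pos φ hφ
  have := timeRate_pos hs
  rw [timeSpeed]
  positivity

theorem le_timeSpeed (h : AngularSol γ η I ξ π e u) (hγ : 0 < γ) (hη : 0 < η) {φ : ℝ}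
    (hφ : φ ∈ I) (he : -(1 / 2) ≤ e φ) :
    η * γ / 4 * Real.sin φ ^ 2 ≤ timeSpeed γ η ξ e φ := by
  have hpos := h.pos φ hφ
  have h1 : 1 / 2 ≤ Real.exp (e φ) := by linarith [Real.add_one_le_exp (e φ)]
  have h2 : 1 / 2 ≤ (ξ φ ^ 2 + transverse η e φ ^ 2) / (ξ φ ^ 2 + 2 * transverse η e φ ^ 2) := by
    rw [div_le_div_iff₀ (by norm_num) (by positivity)]
    nlinarith [sq_nonneg (ξ φ)]
  calc η * γ / 4 * Real.sin φ ^ 2 = η * (γ * (1 / 2) * Real.sin φ ^ 2 * (1 / 2)) := by ring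
    _ ≤ timeSpeed γ η ξ e φ := by
      rw [timeSpeed]
      have := sin_sq_le_timeRate φ
      have := timeRate_nonneg φ
      gcongr

theorem le_time_sub {a b : ℝ} (h : AngularSol γ η (Set.Ioo a b) ξ π e u) (hγ : 0 < γ) (hη : 0 < η)
    (he : ∀ φ ∈ Set.Ioo a b, -(1 / 2) ≤ e φ) {c d : ℝ} (hc : c ∈ Set.Ioo a b)
    (hd : d ∈ Set.Ioo a b) (hcd : c ≤ d) :
    η * γ / 4 * ((d / 2 - Real.sin (2 * d) / 4) - (c / 2 - Real.sin (2 * c) / 4)) ≤ u d - u c := by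
  -- `φ / 2 - sin (2φ) / 4` is a primitive of `sin² φ`, the lower bound for the time speed.
  have hder : ∀ φ ∈ Set.Ioo a b, HasDerivAt
      (fun φ => u φ - η * γ / 4 * (φ / 2 - Real.sin (2 * φ) / 4))
      (timeSpeed γ η ξ e φ - η * γ / 4 * Real.sin φ ^ 2) φ := fun φ hφ => by
    have h1 : HasDerivAt (fun φ => Real.sin (2 * φ)) (Real.cos (2 * φ) * (2 * 1)) φ :=
      ((hasDerivAt_id φ).const_mul 2).sin
    refine ((h.deriv_u φ hφ).sub ((((hasDerivAt_id φ).div_const 2).sub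
      (h1.div_const 4)).const_mul (η * γ / 4))).congr_deriv ?_
    rw [Real.cos_two_mul, Real.cos_sq']
    ring
  have hmono : MonotoneOn (fun φ => u φ - η * γ / 4 * (φ / 2 - Real.sin (2 * φ) / 4))
      (Set.Ioo a b) := by
    refine monotoneOn_of_deriv_nonneg (convex_Ioo a b)
      (fun φ hφ => (hder φ hφ).continuousAt.continuousWithinAt) ?_ ?_ <;> rw [interior_Ioo]
    · exact fun φ hφ => (hder φ hφ).differentiableAt.differentiableWithinAt
    · intro φ hφ
      rw [(hder φ hφ).deriv, sub_nonneg]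
      exact h.le_timeSpeed hγ hη hφ (he φ hφ)
  have := hmono hc hd hcd
  simp only at this
  linarith

theorem strictMonoOn_time {a b : ℝ} (h : AngularSol γ η (Set.Ioo a b) ξ π e u) (hγ : 0 < γ)
    (hη : 0 < η) (he : ∀ φ ∈ Set.Ioo a b, -(1 / 2) ≤ e φ) : StrictMonoOn u (Set.Ioo a b) := by
  intro c hc d hd hcd
  have h1 := h.le_time_sub hγ hη he hc hd hcd.le
  -- This strict inequality keeps the integrated lower bound positive although `sin²` has zeros.
  have h2 : Real.sin (2 * d) - Real.sin (2 * c) < 2 * (d - c) := by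
    rw [Real.sin_sub_sin, show (2 * d - 2 * c) / 2 = d - c by ring]
    have h5 : |Real.sin (d - c)| < d - c := by
      simpa [abs_of_pos (sub_pos.2 hcd)] using Real.abs_sin_lt_abs (sub_pos.2 hcd).ne'
    have h6 : Real.sin (d - c) * Real.cos ((2 * d + 2 * c) / 2) ≤ |Real.sin (d - c)| := by
      refine (le_abs_self _).trans ?_
      rw [abs_mul]
      exact mul_le_of_le_one_right (abs_nonneg _) (Real.abs_cos_le_one _)
    linarith
  have : 0 < η * γ / 4 * ((d / 2 - Real.sin (2 * d) / 4) - (c / 2 - Real.sin (2 * c) / 4)) := by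
    refine mul_pos (by positivity) ?_
    linarith
  linarith

/-- Solutions of the regularized equations give generalized solutions. -/
theorem exists_coordSol {φ₀ φ₁ X ς : ℝ}
    (h : AngularSol γ η (Set.Ioo (φ₀ - 1) (φ₁ + 1)) ξ π e u) (hγ : 0 < γ) (hη : 0 < η)
    (hX : 0 < X) (hς : ς ^ 2 = 1) (he : ∀ φ ∈ Set.Ioo (φ₀ - 1) (φ₁ + 1), -(1 / 2) ≤ e φ)
    (hφ : φ₀ < φ₁) (h0 : Real.sin φ₀ ≠ 0) (h1 : Real.sin φ₁ ≠ 0) (hu0 : u φ₀ = 0) :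
    ∃ (Y : Finset ℝ) (x y px py : ℝ → ℝ), CoordSol (γ ^ 2) (X * u φ₁) Y x y px py ∧
      x 0 = ς * X * ξ φ₀ ∧ y 0 = X * transverse η e φ₀ ∧ px 0 = ς * π φ₀ ∧
      py 0 = γ * angleMomentum φ₀ := by
  have hς0 : ς ≠ 0 := by rintro rfl; norm_num at hς
  have hu := h.strictMonoOn_time hγ hη he
  have hcont : ContinuousOn u (Set.Ioo (φ₀ - 1) (φ₁ + 1)) := fun φ hφ =>
    (h.deriv_u φ hφ).continuousAt.continuousWithinAt
  obtain ⟨θ, hθ⟩ := exists_continuous_inverse hu hcont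
  have hsub : Set.Icc φ₀ φ₁ ⊆ Set.Ioo (φ₀ - 1) (φ₁ + 1) :=
    Set.Icc_subset_Ioo (by linarith) (by linarith)
  have m0 : φ₀ ∈ Set.Icc φ₀ φ₁ := Set.left_mem_Icc.2 hφ.le
  have m1 : φ₁ ∈ Set.Icc φ₀ φ₁ := Set.right_mem_Icc.2 hφ.le
  set T := X * u φ₁ with hT
  have hu1 : 0 < u φ₁ := hu0 ▸ hu (hsub m0) (hsub m1) hφ
  have hTpos : 0 < T := mul_pos hX hu1
  -- The equations are invariant under scaling positions and time by `X` with momenta fixed, so real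
  -- time is `X` times `u`.
  let Θ : ℝ → ℝ := fun t => θ (t / X)
  have hΘ : ∀ t ∈ Set.Icc 0 T, Θ t ∈ Set.Icc φ₀ φ₁ ∧ u (Θ t) = t / X := fun t ht => by
    have : t / X ∈ Set.Icc (u φ₀) (u φ₁) := by
      rw [hu0]
      exact ⟨div_nonneg ht.1 hX.le, by rw [div_le_iff₀ hX, mul_comm]; exact ht.2⟩
    obtain ⟨φ, hφ', hφt⟩ := intermediate_value_Icc hφ.le (hcont.mono hsub) this
    have : Θ t = φ := by simp only [Θ]; rw [← hφt]; exact (hθ φ (hsub hφ')).1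
    rw [this]
    exact ⟨hφ', hφt⟩
  have hΘ0 : Θ 0 = φ₀ := by
    simp only [Θ]; rw [zero_div, ← hu0]; exact (hθ φ₀ (hsub m0)).1
  have hΘT : Θ T = φ₁ := by
    simp only [Θ]; rw [hT, mul_div_cancel_left₀ _ hX.ne']; exact (hθ φ₁ (hsub m1)).1
  have hΘm : StrictMonoOn Θ (Set.Icc 0 T) := fun t ht t' ht' htt' => by
    refine (hu.lt_iff_lt (hsub (hΘ t ht).1) (hsub (hΘ t' ht').1)).1 ?_
    rw [(hΘ t ht).2, (hΘ t' ht').2]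
    exact div_lt_div_of_pos_right htt' hX
  have hΘc : ∀ t ∈ Set.Icc 0 T, ContinuousAt Θ t := fun t ht => by
    have := (hθ (Θ t) (hsub (hΘ t ht).1)).2.1
    rw [(hΘ t ht).2] at this
    exact this.comp (f := fun t : ℝ => t / X) (continuous_id.div_const X).continuousAt
  have hΘd : ∀ t ∈ Set.Icc 0 T, Real.sin (Θ t) ≠ 0 →
      HasDerivAt Θ ((timeSpeed γ η ξ e (Θ t))⁻¹ * (1 / X)) t := fun t ht hs => by
    have hm := hsub (hΘ t ht).1
    have h2 := hθ (Θ t) hm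
    rw [(hΘ t ht).2] at h2
    have h3 : HasDerivAt θ (timeSpeed γ η ξ e (Θ t))⁻¹ (t / X) :=
      HasDerivAt.of_local_left_inverse h2.2.1 (h.deriv_u _ hm) (h.timeSpeed_pos hγ hη hm hs).ne'
        h2.2.2
    exact h3.comp t ((hasDerivAt_id t).div_const X)
  have hfin : {t ∈ Set.Icc 0 T | Real.sin (Θ t) = 0}.Finite := by
    refine Set.Finite.of_injOn (f := Θ) (t := {φ ∈ Set.Icc φ₀ φ₁ | Real.sin φ = 0})
      (fun t ht => ⟨(hΘ t ht.1).1, ht.2⟩) (hΘm.injOn.mono fun t ht => ht.1)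
      (finite_sin_eq_zero φ₀ φ₁)
  have hY : ∀ t, t ∈ hfin.toFinset ↔ t ∈ Set.Icc 0 T ∧ Real.sin (Θ t) = 0 := fun t => by
    simp
  have hY' : ∀ t ∈ Set.Icc 0 T, t ∉ hfin.toFinset → Real.sin (Θ t) ≠ 0 := fun t ht hn hs =>
    hn ((hY t).2 ⟨ht, hs⟩)
  have htimes : ∀ σ ∈ hfin.toFinset, σ ∈ Set.Ioo 0 T := fun σ hσ => by
    obtain ⟨hm, hs⟩ := (hY σ).1 hσ
    refine ⟨hm.1.lt_of_ne ?_, hm.2.lt_of_ne ?_⟩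
    · rintro rfl; rw [hΘ0] at hs; exact h0 hs
    · rintro rfl; rw [hΘT] at hs; exact h1 hs
  have hct : ∀ φ ∈ Set.Icc φ₀ φ₁, ContinuousAt (transverse η e) φ := fun φ hφ =>
    (h.hasDerivAt_transverse (hsub hφ)).continuousAt
  have htne : ∀ φ, Real.sin φ ≠ 0 → transverse η e φ ≠ 0 := fun φ hs =>
    mul_ne_zero (mul_ne_zero hη.ne' (Real.exp_ne_zero _)) hs
  refine ⟨hfin.toFinset, fun t => ς * X * ξ (Θ t), fun t => X * transverse η e (Θ t),
    fun t => ς * π (Θ t), fun t => γ * angleMomentum (Θ t), ?_, by simp only [hΘ0],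
    by simp only [hΘ0], by simp only [hΘ0], by simp only [hΘ0]⟩
  refine ⟨htimes, fun t ht => ?_, fun t ht => ?_, fun t ht _ => ?_, fun t ht htY => ?_,
    fun t ht htY => ?_, fun t ht htY => ?_, fun t ht htY => ?_, fun t ht htY => ?_, ?_,
    fun σ hσ => Or.inl ?_⟩
  · exact (continuousAt_const.mul (((h.deriv_ξ _ (hsub (hΘ t ht).1)).continuousAt).comp
      (hΘc t ht))).continuousWithinAt
  · exact (continuousAt_const.mul ((hct _ (hΘ t ht).1).comp (hΘc t ht))).continuousWithinAt
  · exact mul_ne_zero (mul_ne_zero hς0 hX.ne') (h.pos _ (hsub (hΘ t ht).1)).ne'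
  · exact mul_ne_zero hX.ne' (htne _ (hY' t ht htY))
  · have hm := hsub (hΘ t ht).1
    have hs := hY' t ht htY
    have hτ := (h.timeSpeed_pos hγ hη hm hs).ne'
    refine (((h.deriv_ξ _ hm).comp t (hΘd t ht hs)).const_mul
      (ς * X)).hasDerivWithinAt.congr_deriv ?_
    field_simp
  · have hm := hsub (hΘ t ht).1
    have hs := hY' t ht htY
    have hpos := h.pos _ hm
    have hr := timeRate_pos hs
    refine (((h.hasDerivAt_transverse hm).comp t (hΘd t ht hs)).const_mul
      X).hasDerivWithinAt.congr_deriv ?_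
    simp only [timeSpeed, angleMomentum]
    have h3 : ξ (Θ t) ^ 2 + transverse η e (Θ t) ^ 2 ≠ 0 := by positivity
    have h4 : ξ (Θ t) ^ 2 + 2 * transverse η e (Θ t) ^ 2 ≠ 0 := by positivity
    field_simp
  · have hm := hsub (hΘ t ht).1
    have hs := hY' t ht htY
    have hτ := (h.timeSpeed_pos hγ hη hm hs).ne'
    have hpos := h.pos _ hm
    refine (((h.deriv_π _ hm).comp t (hΘd t ht hs)).const_mul ς).hasDerivWithinAt.congr_deriv ?_
    have h3 : ξ (Θ t) ^ 2 + transverse η e (Θ t) ^ 2 ≠ 0 := by positivity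
    have h4 : (ς * X * ξ (Θ t)) ^ 2 + (X * transverse η e (Θ t)) ^ 2 =
        X ^ 2 * (ξ (Θ t) ^ 2 + transverse η e (Θ t) ^ 2) := by
      rw [mul_pow, mul_pow, hς]; ring
    have h5 : 1 / (ς * X * ξ (Θ t)) = ς / (X * ξ (Θ t)) := by
      field_simp
      rw [hς]
    simp only [h4, h5]
    field_simp
  · have hm := hsub (hΘ t ht).1
    have hs := hY' t ht htY
    have hpos := h.pos _ hm
    have hr := timeRate_pos hs
    refine (((hasDerivAt_angleMomentum hs).comp t (hΘd t ht hs)).const_mul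
      γ).hasDerivWithinAt.congr_deriv ?_
    have h3 : ξ (Θ t) ^ 2 + transverse η e (Θ t) ^ 2 ≠ 0 := by positivity
    have h3' : ξ (Θ t) ^ 2 + 2 * transverse η e (Θ t) ^ 2 ≠ 0 := by positivity
    have h4 : (ς * X * ξ (Θ t)) ^ 2 + (X * transverse η e (Θ t)) ^ 2 =
        X ^ 2 * (ξ (Θ t) ^ 2 + transverse η e (Θ t) ^ 2) := by
      rw [mul_pow, mul_pow, hς]; ring
    have h5 := htne _ hs
    have h6 : Real.sin (Θ t) * (η * Real.exp (e (Θ t))) = transverse η e (Θ t) := by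
      rw [transverse]; ring
    -- The factor `timeRate` cancels between the derivative of `angleMomentum` and the time speed.
    have h7 : γ * (-(timeRate (Θ t) / Real.sin (Θ t)) *
        ((timeSpeed γ η ξ e (Θ t))⁻¹ * (1 / X))) =
        -((ξ (Θ t) ^ 2 + 2 * transverse η e (Θ t) ^ 2) / ((Real.sin (Θ t) *
          (η * Real.exp (e (Θ t)))) * X * (ξ (Θ t) ^ 2 + transverse η e (Θ t) ^ 2))) := by
      rw [timeSpeed]
      field_simp
    rw [h7, h6]
    simp only [h4]
    field_simp
    ring
  · obtain ⟨E, hE⟩ := h.exists_energy_eq hγ isOpen_Ioo isPreconnected_Ioo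
    refine ⟨E + Real.log X + Real.log X + Real.log (X ^ 2) / 2 + Real.log η, fun t ht htY => ?_⟩
    have hm := hsub (hΘ t ht).1
    have hs := hY' t ht htY
    have hpos := h.pos _ hm
    have h3 : ξ (Θ t) ^ 2 + transverse η e (Θ t) ^ 2 ≠ 0 := by positivity
    have h4 : (ς * X * ξ (Θ t)) ^ 2 + (X * transverse η e (Θ t)) ^ 2 =
        X ^ 2 * (ξ (Θ t) ^ 2 + transverse η e (Θ t) ^ 2) := by
      rw [mul_pow, mul_pow, hς]; ring
    -- Here `ς = ±1`, and `Real.log (-1) = 0`.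
    have h5 : Real.log ς = 0 := by
      rcases mul_self_eq_one_iff.1 (show ς * ς = 1 by rw [← sq, hς]) with rfl | rfl <;> simp
    have h6 := angleMomentum_sq hs
    rw [Real.log_pow] at h6
    push_cast at h6
    have h7 : ((ς * π (Θ t)) ^ 2 + (γ * angleMomentum (Θ t)) ^ 2) / (2 * γ ^ 2) =
        π (Θ t) ^ 2 / (2 * γ ^ 2) + angleMomentum (Θ t) ^ 2 / 2 := by
      rw [mul_pow, hς]; field_simp
    simp only [h4]
    rw [← hE _ hm, h7, h6, Real.log_mul (pow_ne_zero 2 hX.ne') h3,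
      Real.log_mul (mul_ne_zero hς0 hX.ne') hpos.ne', Real.log_mul hς0 hX.ne', h5,
      Real.log_mul hX.ne' (htne _ hs), transverse,
      Real.log_mul (mul_ne_zero hη.ne' (Real.exp_ne_zero _)) hs,
      Real.log_mul hη.ne' (Real.exp_ne_zero _), Real.log_exp]
    ring
  · obtain ⟨hm, hs⟩ := (hY σ).1 hσ
    have hσT := htimes σ hσ
    refine ⟨?_, ?_, ⟨?_, ⟨ς * π (Θ σ), ?_⟩⟩⟩
    · simp only [transverse, hs, mul_zero]
    · exact mul_ne_zero (mul_ne_zero hς0 hX.ne') (h.pos _ (hsub (hΘ σ hm).1)).ne'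
    · have c1 : Tendsto (fun s : ℝ => σ + s) (𝓝 0) (𝓝 σ) := by
        exact (by fun_prop : Continuous fun s : ℝ => σ + s).tendsto' 0 σ (add_zero σ)
      have c2 : Tendsto (fun s : ℝ => σ - s) (𝓝 0) (𝓝 σ) := by
        exact (by fun_prop : Continuous fun s : ℝ => σ - s).tendsto' 0 σ (sub_zero σ)
      -- Staying within `π` of the collision angle prevents the angle from reaching a neighbouring
      -- zero of `sin`.
      have n1 : ∀ᶠ t in 𝓝 σ, t ∈ Set.Icc 0 T ∧ |Θ t - Θ σ| < Real.pi :=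
        Filter.Eventually.and (Icc_mem_nhds hσT.1 hσT.2)
          ((((hΘc σ hm).sub continuousAt_const).abs).eventually_lt_const
            (show |Θ σ - Θ σ| < Real.pi by simpa using Real.pi_pos))
      filter_upwards [(c1.eventually n1).filter_mono nhdsWithin_le_nhds,
        (c2.eventually n1).filter_mono nhdsWithin_le_nhds, self_mem_nhdsWithin] with s hs1 hs2 hs0
      have hs0' : 0 < s := hs0
      have k1 := hΘm hm hs1.1 (by linarith)
      have k2 := hΘm hs2.1 hm (by linarith)
      have key := sin_mul_sin_neg hs k2 k1 (by linarith [(abs_lt.1 hs2.2).1])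
        (abs_lt.1 hs1.2).2
      have hp : 0 < (X * (η * Real.exp (e (Θ (σ + s))))) * (X * (η * Real.exp (e (Θ (σ - s))))) := by
        positivity
      have := mul_neg_of_pos_of_neg hp key
      simp only [transverse]
      linarith
    · exact ((continuousAt_const.mul (((h.deriv_π _ (hsub (hΘ σ hm).1)).continuousAt).comp
        (hΘc σ hm))).tendsto.mono_left nhdsWithin_le_nhds)

end AngularSol

end DihedralVortex

end

/-! ### Choice of constants and the two halves combined. -/

noncomputable section

namespace DihedralVortex

/-- The transverse energy fixes the amplitude, hence `sin φ`, up to the sign of `y₀`. The choice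
between `arcsin` and `π - arcsin` gives `cos φ` the sign of `p`. -/
theorem exists_initial_angle {γ y₀ : ℝ} (hγ : 0 < γ) (hy : y₀ ≠ 0) (p : ℝ) :
    ∃ φ, Real.sin φ ≠ 0 ∧ |y₀| * Real.exp (p ^ 2 / (2 * γ ^ 2)) * Real.sin φ = y₀ ∧
      γ * angleMomentum φ = p := by
  obtain ⟨ς, hς, hςy⟩ : ∃ ς : ℝ, ς ^ 2 = 1 ∧ |y₀| * ς = y₀ := by
    rcases hy.lt_or_gt with h | h
    · exact ⟨-1, by norm_num, by rw [abs_of_neg h]; ring⟩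
    · exact ⟨1, by norm_num, by rw [abs_of_pos h]; ring⟩
  have hς0 : ς ≠ 0 := by rintro rfl; norm_num at hς
  set a := ς * Real.exp (-(p ^ 2 / (2 * γ ^ 2))) with ha
  have ha0 : a ≠ 0 := mul_ne_zero hς0 (Real.exp_ne_zero _)
  have ha2 : a ^ 2 = Real.exp (-(p ^ 2 / γ ^ 2)) := by
    rw [ha, mul_pow, hς, one_mul, ← Real.exp_nat_mul]
    congr 1; push_cast; field_simp
  have ha1 : |a| ≤ 1 := by
    rw [← sq_le_one_iff_abs_le_one, ha2, Real.exp_le_one_iff]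
    have : 0 ≤ p ^ 2 / γ ^ 2 := by positivity
    linarith
  have hsin := Real.sin_arcsin (abs_le.1 ha1).1 (abs_le.1 ha1).2
  have hcos := Real.cos_arcsin_nonneg a
  have key : ∀ φ, Real.sin φ = a → 0 ≤ Real.cos φ * p → Real.sin φ ≠ 0 ∧
      |y₀| * Real.exp (p ^ 2 / (2 * γ ^ 2)) * Real.sin φ = y₀ ∧ γ * angleMomentum φ = p := by
    intro φ hφ hp
    have hs : Real.sin φ ≠ 0 := by rw [hφ]; exact ha0
    refine ⟨hs, ?_, ?_⟩
    · rw [hφ, ha, mul_mul_mul_comm, hςy, ← Real.exp_add]; simp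
    · have h1 : (γ * angleMomentum φ) ^ 2 = p ^ 2 := by
        rw [mul_pow, angleMomentum_sq hs, hφ, ha2, Real.log_exp]; field_simp
      have h2 : 0 ≤ γ * angleMomentum φ * p := by
        have : γ * angleMomentum φ * p = γ / timeRate φ * (Real.cos φ * p) := by
          rw [angleMomentum]; ring
        rw [this]
        exact mul_nonneg (div_nonneg hγ.le (timeRate_nonneg φ)) hp
      rcases sq_eq_sq_iff_eq_or_eq_neg.1 h1 with h | h
      · exact h
      · rw [h] at h2 ⊢
        have : p = 0 := by nlinarith
        rw [this, neg_zero]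
  rcases le_total 0 p with hp | hp
  · exact ⟨_, key _ hsin (mul_nonneg hcos hp)⟩
  · refine ⟨Real.pi - Real.arcsin a, key _ (by rw [Real.sin_pi_sub, hsin]) ?_⟩
    rw [Real.cos_pi_sub]
    nlinarith

/-- The theorem in Cartesian coordinates, for rectangles that are long in the direction of `x`. -/
theorem exists_coordSol_and_forall {Γ : ℝ} (hΓ : 0 < Γ) (n : ℕ) (P : ℝ) :
    ∃ R : ℝ, 1 < R ∧ ∀ x₀ y₀ px₀ py₀ : ℝ, x₀ ≠ 0 → y₀ ≠ 0 → R * |y₀| ≤ |x₀| → |px₀| ≤ P →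
      |py₀| ≤ P → ∃ T : ℝ, 0 < T ∧
        (∃ (Y : Finset ℝ) (x y px py : ℝ → ℝ), CoordSol Γ T Y x y px py ∧
          x 0 = x₀ ∧ y 0 = y₀ ∧ px 0 = px₀ ∧ py 0 = py₀) ∧
        ∀ (Y : Finset ℝ) (x y px py : ℝ → ℝ), CoordSol Γ T Y x y px py →
          x 0 = x₀ → y 0 = y₀ → px 0 = px₀ → py 0 = py₀ →
            n ≤ Y.card ∧ ∀ σ ∈ Y, y σ = 0 ∧ x σ ≠ 0 := by
  obtain ⟨γ, hγ, rfl⟩ : ∃ γ : ℝ, 0 < γ ∧ γ ^ 2 = Γ := ⟨√Γ, Real.sqrt_pos.2 hΓ, Real.sq_sqrt hΓ.le⟩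
  have hpi := Real.pi_pos
  -- The a priori bound on a gap per unit of `|y₀|`, using `px² + py² ≤ 2 P²`. `N` is the number of
  -- half-turns whose duration, at least `γπ/8` each in the same units, exceeds `n + 1` gaps.
  set A := 3 * γ * (8 * Real.exp (P ^ 2 / γ ^ 2)) with hA
  have hApos : 0 < A := by positivity
  obtain ⟨N, hN⟩ := exists_nat_gt ((n + 1) * A / (γ * Real.pi / 8))
  rw [div_lt_iff₀ (by positivity)] at hN
  have hN0 : 0 < (N : ℝ) := by
    have : 0 < (n + 1) * A := by positivity
    exact pos_of_mul_pos_left (this.trans hN) (by positivity)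
  obtain ⟨C, hC, hflow⟩ := exists_angularSol γ P (P ^ 2 / (2 * γ ^ 2))
  -- The extra `1` keeps the final angle in the interior of the interval of existence.
  set ℓ := N * Real.pi + 1 with hℓ
  have hNpi : 0 < N * Real.pi := by positivity
  have hℓ1 : 1 ≤ ℓ := by linarith
  have hC1 : 0 < C * ℓ := by positivity
  have hC2 : 0 < 4 * (|P| + 1) * (C * ℓ) / γ ^ 2 := by positivity
  -- The three summands of `R` ensure `η ≤ 1`, `T ≤ X / 4`, and that the longitudinal displacement
  -- stays below `X / 2`.
  refine ⟨1 + 4 * (C * ℓ) + 4 * (|P| + 1) * (C * ℓ) / γ ^ 2, by linarith,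
    fun x₀ y₀ px₀ py₀ hx₀ hy₀ hR hpx hpy => ?_⟩
  have hX : 0 < |x₀| := abs_pos.2 hx₀
  have hε : 0 < |y₀| := abs_pos.2 hy₀
  set X := |x₀| with hXdef
  set η := |y₀| / X with hηdef
  have hη : 0 < η := by positivity
  have hXη : X * η = |y₀| := by rw [hηdef]; field_simp
  have hRη : η * (1 + 4 * (C * ℓ) + 4 * (|P| + 1) * (C * ℓ) / γ ^ 2) ≤ 1 := by
    rw [hηdef, div_mul_eq_mul_div, div_le_one hX, mul_comm]; exact hR
  have e1 : 0 < η * (4 * (C * ℓ)) := by positivity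
  have e2 : 0 < η * (4 * (|P| + 1) * (C * ℓ) / γ ^ 2) := by positivity
  rw [mul_add, mul_add, mul_one] at hRη
  have hη1 : η ≤ 1 := by linarith
  have hs1 : 4 * (C * η * ℓ) ≤ 1 := by
    have : 4 * (C * η * ℓ) = η * (4 * (C * ℓ)) := by ring
    linarith
  have hs2 : 4 * (|P| + 1) * (C * η * ℓ) ≤ γ ^ 2 := by
    have : η * (4 * (|P| + 1) * (C * ℓ) / γ ^ 2) = 4 * (|P| + 1) * (C * η * ℓ) / γ ^ 2 := by ring
    rw [this] at e2 hRη
    rw [← div_le_one (by positivity)]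
    linarith
  obtain ⟨ς, hς, hςx, hς1⟩ : ∃ ς : ℝ, ς ^ 2 = 1 ∧ ς * X = x₀ ∧ |ς| = 1 := by
    rcases hx₀.lt_or_gt with h | h
    · exact ⟨-1, by norm_num, by rw [hXdef, abs_of_neg h]; ring, by norm_num⟩
    · exact ⟨1, by norm_num, by rw [hXdef, abs_of_pos h]; ring, by norm_num⟩
  obtain ⟨φ₀, hsin, hyφ, hpφ⟩ := exists_initial_angle hγ hy₀ py₀
  have hpx2 : px₀ ^ 2 ≤ P ^ 2 := sq_le_sq' (abs_le.1 hpx).1 (abs_le.1 hpx).2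
  have hpy2 : py₀ ^ 2 ≤ P ^ 2 := sq_le_sq' (abs_le.1 hpy).1 (abs_le.1 hpy).2
  obtain ⟨ξ, π, e, u, hsol, hξ0, hπ0, he0, hu0, hbd⟩ := hflow η ℓ hη hη1 hℓ1 (by linarith) φ₀
    (ς * px₀) (py₀ ^ 2 / (2 * γ ^ 2)) (by rwa [abs_mul, hς1, one_mul]) (by positivity)
    (by gcongr)
  -- A whole number of half-turns makes `sin φ₁ = ± sin φ₀ ≠ 0`, so time `T` is not a collision, and
  -- cancels the oscillating part of the lower bound for time.
  set φ₁ := φ₀ + N * Real.pi with hφ₁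
  have hI : φ₀ + ℓ = φ₁ + 1 := by rw [hφ₁, hℓ]; ring
  rw [hI] at hsol hbd
  have hφ : φ₀ < φ₁ := by linarith
  have hsin1 : Real.sin φ₁ ≠ 0 := by
    rw [hφ₁, Real.sin_add_nat_mul_pi]
    exact mul_ne_zero (pow_ne_zero _ (by norm_num)) hsin
  have hsub : Set.Icc φ₀ φ₁ ⊆ Set.Ioo (φ₀ - 1) (φ₁ + 1) :=
    Set.Icc_subset_Ioo (by linarith) (by linarith)
  have hu_lower : η * γ / 4 * (N * Real.pi / 2) ≤ u φ₁ := by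
    have := hsol.le_time_sub hγ hη (fun φ hφ => (hbd φ hφ).1) (hsub (Set.left_mem_Icc.2 hφ.le))
      (hsub (Set.right_mem_Icc.2 hφ.le)) hφ.le
    rw [hu0, sub_zero, show 2 * φ₁ = 2 * φ₀ + N * (2 * Real.pi) by rw [hφ₁]; ring,
      Real.sin_add_nat_mul_two_pi] at this
    refine le_trans (le_of_eq ?_) this
    rw [hφ₁]; ring
  have hu_upper : u φ₁ ≤ C * η * ℓ := by
    have := abs_sub_le_of_hasDerivAt_off_finset (f := u) (C := C * η) ∅ hφ.le
      (fun φ hφ' => (hsol.deriv_u φ (hsub hφ')).continuousAt.continuousWithinAt)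
      fun φ hφ' _ => ⟨_, hsol.deriv_u φ (hsub (Set.Ioo_subset_Icc_self hφ')),
        (hbd φ (hsub (Set.Ioo_subset_Icc_self hφ'))).2⟩
    rw [hu0, sub_zero] at this
    refine (le_abs_self _).trans (this.trans ?_)
    gcongr
    linarith
  have hupos : 0 < u φ₁ := lt_of_lt_of_le (by positivity) hu_lower
  refine ⟨X * u φ₁, by positivity, ?_, ?_⟩
  · obtain ⟨Y, x, y, px, py, h, i1, i2, i3, i4⟩ := hsol.exists_coordSol hγ hη hX hς
      (fun φ hφ => (hbd φ hφ).1) hφ hsin hsin1 hu0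
    refine ⟨Y, x, y, px, py, h, ?_, ?_, ?_, ?_⟩
    · rw [i1, hξ0, mul_one, hςx]
    · rw [i2, transverse, he0, ← mul_assoc, ← mul_assoc, hXη, hyφ]
    · rw [i3, hπ0, ← mul_assoc, ← sq, hς, one_mul]
    · rw [i4, hpφ]
  -- No uniqueness is needed: an arbitrary solution is never compared with the constructed one, and
  -- only the two-sided bound on `T` enters.
  · rintro Y x y px py h rfl rfl rfl rfl
    have hP : |px 0| + 1 ≤ |P| + 1 := by linarith [le_abs_self P]
    have hT : X * u φ₁ ≤ X * (C * η * ℓ) := by gcongr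
    have h1 : 4 * (X * u φ₁) ≤ X := by linarith [mul_le_mul_of_nonneg_left hs1 hX.le]
    have h2 : (|px 0| + 1) * (X * u φ₁) < γ ^ 2 * (X / 2) := by
      have k1 : (|px 0| + 1) * (X * u φ₁) ≤ (|P| + 1) * (X * (C * η * ℓ)) := by gcongr
      have k2 : (|P| + 1) * (X * (C * η * ℓ)) ≤ γ ^ 2 * (X / 4) := by
        linarith [mul_le_mul_of_nonneg_left hs2 hX.le]
      have k3 : γ ^ 2 * (X / 4) < γ ^ 2 * (X / 2) := by
        gcongr
        norm_num
      linarith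
    have hyx : |y 0| ≤ |x 0| := by
      have := mul_le_mul_of_nonneg_left hη1 hX.le
      rwa [hXη, mul_one] at this
    obtain ⟨k1, k2⟩ := h.length_le_and_collisions hΓ (by positivity) hx₀ hy₀ hyx h1 h2
    refine ⟨?_, k2⟩
    rw [Real.sqrt_sq hγ.le] at k1
    have k3 : 3 * γ * (8 * Real.exp ((px 0 ^ 2 + py 0 ^ 2) / (2 * γ ^ 2)) * |y 0|) ≤ A * |y 0| := by
      rw [hA, ← mul_assoc]
      have : (px 0 ^ 2 + py 0 ^ 2) / (2 * γ ^ 2) ≤ P ^ 2 / γ ^ 2 := by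
        rw [show P ^ 2 / γ ^ 2 = (P ^ 2 + P ^ 2) / (2 * γ ^ 2) by field_simp; ring]
        gcongr
      gcongr
    have k4 : (n + 1) * A * |y 0| < (Y.card + 1) * A * |y 0| := by
      calc (n + 1) * A * |y 0| < N * (γ * Real.pi / 8) * |y 0| := by gcongr
        _ = X * (η * γ / 4 * (N * Real.pi / 2)) := by rw [← hXη]; ring
        _ ≤ X * u φ₁ := by gcongr
        _ ≤ _ := k1
        _ ≤ (Y.card + 1) * (A * |y 0|) := by gcongr
        _ = _ := by ring
    have k5 : (n : ℝ) + 1 < Y.card + 1 :=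
      lt_of_mul_lt_mul_right (lt_of_mul_lt_mul_right k4 hε.le) hApos.le
    have : n < Y.card := by exact_mod_cast (by linarith : (n : ℝ) < Y.card)
    exact this.le

theorem mul_abs_le_abs_of_le_aspectRatio {R : ℝ} {z : ℂ} (hx : z.re ≠ 0) (hy : z.im ≠ 0)
    (h : R ≤ aspectRatio z) : R * |z.im| ≤ |z.re| ∨ R * |z.re| ≤ |z.im| := by
  have hx' := abs_pos.2 hx
  have hy' := abs_pos.2 hy
  rw [aspectRatio, le_div_iff₀ (lt_min hx' hy')] at h
  rcases le_total |z.re| |z.im| with hle | hle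
  · rw [max_eq_right hle, min_eq_left hle] at h; exact Or.inr h
  · rw [max_eq_left hle, min_eq_right hle] at h; exact Or.inl h

end DihedralVortex

end

theorem mainTheorem7 (Γ : ℝ) (hΓ : 0 < Γ) (n : ℕ) (P : ℝ) :
    ∃ R : ℝ, ∀ z₀ p₀ : ℂ, DihedralVortex.CollisionFree z₀ →
      R ≤ DihedralVortex.aspectRatio z₀ → ‖p₀‖ ≤ P →
      ∃ g : DihedralGroup 2, DihedralVortex.ClosestPairs g z₀ ∧
        ∃ T : ℝ, 0 < T ∧
          (∃ (Y : Finset ℝ) (q p : ℝ → ℂ),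
            DihedralVortex.IsGeneralizedSolution Γ T Y q p ∧ q 0 = z₀ ∧ p 0 = p₀) ∧
          ∀ (Y : Finset ℝ) (q p : ℝ → ℂ),
            DihedralVortex.IsGeneralizedSolution Γ T Y q p → q 0 = z₀ → p 0 = p₀ →
              n ≤ Y.card ∧ ∀ σ ∈ Y, DihedralVortex.BinaryCollision g (q σ) := by
  obtain ⟨R, hR, hmain⟩ := DihedralVortex.exists_coordSol_and_forall hΓ n P
  refine ⟨R, fun z₀ p₀ hfree hasp hp => ?_⟩
  obtain ⟨hx, hy⟩ := (DihedralVortex.collisionFree_iff z₀).1 hfree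
  have hpre : |p₀.re| ≤ P := (Complex.abs_re_le_norm p₀).trans hp
  have hpim : |p₀.im| ≤ P := (Complex.abs_im_le_norm p₀).trans hp
  rcases DihedralVortex.mul_abs_le_abs_of_le_aspectRatio hx hy hasp with h | h
  · refine ⟨.sr 0, DihedralVortex.closestPairs_sr_zero hx hy
      (by nlinarith [abs_pos.2 hy]), ?_⟩
    obtain ⟨T, hT, ⟨Y, x, y, px, py, hsol, i1, i2, i3, i4⟩, hall⟩ :=
      hmain z₀.re z₀.im p₀.re p₀.im hx hy h hpre hpim
    refine ⟨T, hT, ⟨Y, fun t => ⟨x t, y t⟩, fun t => ⟨px t, py t⟩,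
      DihedralVortex.isGeneralizedSolution_iff.2 hsol, Complex.ext i1 i2, Complex.ext i3 i4⟩, ?_⟩
    rintro Y q p hq rfl rfl
    obtain ⟨k1, k2⟩ := hall Y _ _ _ _ (DihedralVortex.isGeneralizedSolution_iff.1 hq) rfl rfl rfl rfl
    exact ⟨k1, fun σ hσ => (DihedralVortex.binaryCollision_sr_zero_iff _).2 (k2 σ hσ)⟩
  · refine ⟨.sr 1, DihedralVortex.closestPairs_sr_one hx hy
      (by nlinarith [abs_pos.2 hx]), ?_⟩
    obtain ⟨T, hT, ⟨Y, x, y, px, py, hsol, i1, i2, i3, i4⟩, hall⟩ :=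
      hmain z₀.im z₀.re p₀.im p₀.re hy hx h hpim hpre
    refine ⟨T, hT, ⟨Y, fun t => ⟨y t, x t⟩, fun t => ⟨py t, px t⟩,
      DihedralVortex.isGeneralizedSolution_iff.2 hsol.swap, Complex.ext i2 i1,
      Complex.ext i4 i3⟩, ?_⟩
    rintro Y q p hq rfl rfl
    obtain ⟨k1, k2⟩ := hall Y _ _ _ _ (DihedralVortex.isGeneralizedSolution_iff.1 hq).swap
      rfl rfl rfl rfl
    exact ⟨k1, fun σ hσ => (DihedralVortex.binaryCollision_sr_one_iff _).2 (k2 σ hσ)⟩
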